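/- For a natural number $n$, let $Q_n$ be the $n$-dimensional hypercube: its vertices are the subsets of $\{1,\dots,n\}$, and two vertices $x,y$ are adjacent if and only if $|x\,\Delta\,y|=1$, where $\Delta$ denotes symmetric difference. Let $P_k$ denote the path with $k$ edges. For graphs $H$ and $G$, an embedding of $H$ into $G$ is an injective map $\theta$ from the vertices of $H$ to the vertices of $G$ that sends edges to edges (its image is a not necessarily induced subgraph $\theta(H)$ of $G$). If $H$ is isomorphic to a subgraph of $G$, we say that $H$ divides $G$ if there exist finitely many embeddings $\theta_1,\dots,\theta_k$ of $H$ into $G$ such that the edge sets $E(\theta_1(H)),\dots,E(\theta_k(H))$ form a partition of $E(G)$. Proposition. Let $n$ and $j$ be natural numbers with $n$ even and $0\le j<n$. Then $P_{2^j}$ divides $Q_n$. -/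

import Mathlib

namespace CubeDecomp

/-- The `n`-dimensional hypercube `Q_n`: vertices are the subsets of an `n`-element set, and `x`, `y`
are adjacent when their symmetric difference has exactly one element. -/
def hypercube (n : ℕ) : SimpleGraph (Finset (Fin n)) where
  Adj x y := (symmDiff x y).card = 1
  symm := ⟨fun x y h => by rwa [symmDiff_comm]⟩
  loopless := ⟨fun x h => by simp at h⟩

/-- The path `P_k` with `k` edges (hence `k + 1` vertices). -/
def kPath (k : ℕ) : SimpleGraph (Fin (k + 1)) :=
  SimpleGraph.pathGraph (k + 1)

/-- The edge set `E(θ(H))` of the image of `H` under an embedding `θ` of `H` into `G`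
(injective on vertices and sending edges to edges; the image need not be an induced subgraph). -/
def imageEdges {V W : Type*} {H : SimpleGraph V} {G : SimpleGraph W}
    (θ : SimpleGraph.Copy H G) : Set (Sym2 W) :=
  Sym2.map θ '' H.edgeSet

/-- `H` divides `G`: `H` is isomorphic to a subgraph of `G`, and there are finitely many embeddings
`θ₁, …, θ_k` of `H` into `G` whose edge sets `E(θ_i(H))` partition `E(G)`. -/
def Divides {V W : Type*} (H : SimpleGraph V) (G : SimpleGraph W) : Prop :=
  H.IsContained G ∧
    ∃ (k : ℕ) (θ : Fin k → SimpleGraph.Copy H G),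
      (Pairwise fun i i' => Disjoint (imageEdges (θ i)) (imageEdges (θ i'))) ∧
        ⋃ i, imageEdges (θ i) = G.edgeSet

end CubeDecomp

namespace CubeDecomp

open SimpleGraph

/-! Everything rests on a Hamilton decomposition: for `n = 2m` the edges of `Q_n` split into `m`
Hamilton cycles of length `2 ^ n`. Since `2 ^ j` is a proper divisor of `2 ^ n`, each cycle can be
cut into consecutive paths with `2 ^ j` edges (`HamDecomposable.divides_kPath`).

`Q_{2m}` is the `m`-fold box product of 4-cycles. The decomposition is built by induction on `m`,
either doubling `m` or adding one to an even value.

Doubling (`HookDecomposable.boxProd_self`): `G □ G` is partitioned by the tori `K i □ K i`, and a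
torus splits into a staircase Hamilton cycle and its transpose.

Adding one (`HookDecomposable.boxProd_fourCycle`): `G □ C₄` consists at first of four parallel
layers of each `K i` and of the columns `{x} × C₄`. A switch on a square above an edge `xy` of `K i`
trades its horizontal sides for its vertical ones, so it can join two layers of `K i` and at the
same time the columns of `x` and `y`. The switched edges form a spanning tree of `V`, which makes
the columns one cycle (`connected_of_columns`). Most cycles carry three switches, one for each pair
of successive layers (`connected_of_layers`). A single cycle `K c₀` carries all the others, along
nearly a whole Hamilton path, at levels that zigzag so that it too becomes one cycle
(`connected_of_zigzag`).

The zigzag is arranged for an even number of side switches, whereas three on each of an odd number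
of cycles is odd. Hence one cycle `K c₁` gets only two, and its missing join comes from an exchange
with `K c₀` on a square supplied by a hook. The hook is part of the induction hypothesis and is
reproduced by both constructions. For `m = 1` there is one cycle and hence no hook, and the
switching needs long cycles, so `m = 2` and `m = 3` are given explicitly. -/

/-! ### Two-regular graphs and Hamilton cycles -/

/-- Every vertex has exactly two neighbours. -/
def TwoRegular {V : Type*} (H : SimpleGraph V) : Prop :=
  ∀ v, ∃ a b, a ≠ b ∧ ∀ y, H.Adj v y ↔ y = a ∨ y = b

/-- `H` is a cycle through all the vertices, enumerated by `ZMod N`. -/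
def IsHamCycle {V : Type*} (N : ℕ) (H : SimpleGraph V) : Prop :=
  ∃ e : V ≃ ZMod N, ∀ x y, H.Adj x y ↔ e y = e x + 1 ∨ e x = e y + 1

theorem TwoRegular.isCycles {V : Type*} {H : SimpleGraph V} (h : TwoRegular H) : H.IsCycles := by
  intro v _
  obtain ⟨a, b, hab, hy⟩ := h v
  have : H.neighborSet v = {a, b} := by
    ext y
    simp [hy]
  rw [this, Set.ncard_pair hab]

theorem TwoRegular.adj_iff_of_adj {V : Type*} {H : SimpleGraph V} (h : TwoRegular H) {v p q : V}
    (hpq : p ≠ q) (hp : H.Adj v p) (hq : H.Adj v q) (y : V) : H.Adj v y ↔ y = p ∨ y = q := by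
  obtain ⟨a, b, hab, hy⟩ := h v
  rw [hy] at hp hq ⊢
  grind

/-- In a finite two-regular graph a closed walk without repetition exhausts the component of its
base point, which here is everything. All later constructions therefore only need two-regularity and
connectedness. -/
theorem TwoRegular.isHamCycle {V : Type*} [Fintype V] {H : SimpleGraph V} (h : TwoRegular H)
    (hc : H.Connected) : IsHamCycle (Fintype.card V) H := by
  classical
  obtain ⟨v⟩ := hc.nonempty
  obtain ⟨a, b, hab, hy⟩ := h v
  obtain ⟨p, hp, hverts⟩ := h.isCycles.exists_cycle_toSubgraph_verts_eq_connectedComponentSupp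
    (c := H.connectedComponentMk v) rfl ⟨a, by simp [hy]⟩
  have hall : ∀ x, x ∈ p.support := fun x => by
    rw [← Walk.mem_verts_toSubgraph, hverts]
    exact ConnectedComponent.sound (hc.preconnected x v)
  have h3 := hp.three_le_length
  have hinj := hp.getVert_injOn'
  have hlen : p.length = Fintype.card V := by
    -- Index `p.length` returns to the base point, so the indices below it list each vertex once.
    have hbij : Function.Bijective (fun k : Fin p.length => p.getVert k) := by
      refine ⟨fun i j hij => Fin.ext (hinj ?_ ?_ hij), fun x => ?_⟩
      · have := i.2
        simp only [Set.mem_ofPred_eq]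
        omega
      · have := j.2
        simp only [Set.mem_ofPred_eq]
        omega
      · obtain ⟨n, hn, hle⟩ := Walk.mem_support_iff_exists_getVert.mp (hall x)
        rcases hle.lt_or_eq with hlt | rfl
        · exact ⟨⟨n, hlt⟩, hn⟩
        · refine ⟨⟨0, by omega⟩, ?_⟩
          rw [← hn]
          simp
    simpa using Fintype.card_congr (Equiv.ofBijective _ hbij)
  rw [← hlen]
  have : NeZero p.length := ⟨by omega⟩
  have : Fact (1 < p.length) := ⟨by omega⟩
  let w : ZMod p.length → V := fun k => p.getVert k.val
  have hw : Function.Bijective w := by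
    refine (Fintype.bijective_iff_injective_and_card w).mpr ⟨fun i j hij => ?_, ?_⟩
    · refine ZMod.val_injective _ (hinj ?_ ?_ hij)
      · have := ZMod.val_lt i
        simp only [Set.mem_ofPred_eq]
        omega
      · have := ZMod.val_lt j
        simp only [Set.mem_ofPred_eq]
        omega
    · rw [ZMod.card, hlen]
  have hsucc : ∀ k, H.Adj (w k) (w (k + 1)) := by
    intro k
    have hk := ZMod.val_lt k
    have hadj := p.adj_getVert_succ hk
    have : w (k + 1) = p.getVert (k.val + 1) := by
      simp only [w]
      rw [ZMod.val_add, ZMod.val_one]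
      rcases Nat.lt_or_ge (k.val + 1) p.length with hlt | hge
      · rw [Nat.mod_eq_of_lt hlt]
      · have : k.val + 1 = p.length := by omega
        rw [this]
        simp
    rw [this]
    exact hadj
  let e := (Equiv.ofBijective w hw).symm
  have he : ∀ x, w (e x) = x := fun x => (Equiv.ofBijective w hw).apply_symm_apply x
  have he' : ∀ k, e (w k) = k := fun k => (Equiv.ofBijective w hw).symm_apply_apply k
  have two_ne : (2 : ZMod p.length) ≠ 0 := by
    intro h2
    have : ((2 : ℕ) : ZMod p.length) = 0 := by exact_mod_cast h2
    rw [ZMod.natCast_eq_zero_iff] at this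
    have := Nat.le_of_dvd (by norm_num) this
    omega
  refine ⟨e, fun x y => ?_⟩
  have h1 := hsucc (e x)
  have h2 := hsucc (e x - 1)
  rw [he] at h1
  rw [sub_add_cancel, he] at h2
  rw [h.adj_iff_of_adj ?_ h1 h2.symm y]
  · constructor
    · rintro (rfl | rfl)
      · exact Or.inl (he' _)
      · right
        rw [he', sub_add_cancel]
    · rintro (hxy | hxy)
      · left
        rw [← hxy, he]
      · right
        rw [hxy, add_sub_cancel_right, he]
  · intro heq
    have := congrArg e heq
    rw [he', he'] at this
    apply two_ne
    linear_combination this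

namespace IsHamCycle

variable {V : Type*} {N : ℕ} {H : SimpleGraph V}

theorem twoRegular (hN : 3 ≤ N) (h : IsHamCycle N H) : TwoRegular H := by
  obtain ⟨e, he⟩ := h
  have two_ne : (2 : ZMod N) ≠ 0 := by
    intro h2
    have : ((2 : ℕ) : ZMod N) = 0 := by exact_mod_cast h2
    rw [ZMod.natCast_eq_zero_iff] at this
    have := Nat.le_of_dvd (by norm_num) this
    omega
  intro v
  refine ⟨e.symm (e v + 1), e.symm (e v - 1), ?_, fun y => ?_⟩
  · intro heq
    apply two_ne
    linear_combination e.symm.injective heq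
  · rw [he, Equiv.eq_symm_apply, Equiv.eq_symm_apply, eq_sub_iff_add_eq, eq_comm (a := e v)]

/-- A cycle with one edge removed is still connected, stated for an arbitrary equivalence
relation. -/
theorem rel_of_forall_ne (hN : 3 ≤ N) (h : IsHamCycle N H) {R : V → V → Prop}
    (hR : Equivalence R) {a b : V} (hab : H.Adj a b)
    (hRel : ∀ x y, H.Adj x y → s(x, y) ≠ s(a, b) → R x y) (x y : V) : R x y := by
  obtain ⟨e, he⟩ := h
  have : NeZero N := ⟨by omega⟩
  wlog hstep : e b = e a + 1 generalizing a b
  · refine this hab.symm (fun x y hxy hne => hRel x y hxy ?_) ?_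
    · rwa [Sym2.eq_swap (a := a)]
    · exact ((he a b).mp hab).resolve_left hstep
  -- Walk from `b` away from `a`: the vertices `b, b + 1, …, b + (N - 1) = a` are reached without
  -- crossing the deleted edge.
  suffices key : ∀ j : ℕ, j < N → R b (e.symm (e b + j)) by
    have hb : ∀ z, R b z := by
      intro z
      have := key (e z - e b).val (ZMod.val_lt _)
      rwa [ZMod.natCast_val, ZMod.cast_id, add_sub_cancel, e.symm_apply_apply] at this
    exact hR.trans (hR.symm (hb x)) (hb y)
  intro j
  induction j with
  | zero => intro _; simpa using hR.refl b
  | succ j ih =>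
    intro hj
    refine hR.trans (ih (by omega)) (hRel _ _ ?_ ?_)
    · rw [he]
      left
      simp [add_assoc]
    · intro heq
      have hz : ((j + 1 : ℕ) : ZMod N) ≠ 0 := by
        rw [Ne, ZMod.natCast_eq_zero_iff]
        intro hd
        have := Nat.le_of_dvd (by omega) hd
        omega
      rw [Sym2.eq_iff, Equiv.symm_apply_eq, Equiv.symm_apply_eq, Equiv.symm_apply_eq,
        Equiv.symm_apply_eq] at heq
      rcases heq with ⟨h1, _⟩ | ⟨h1, h2⟩
      · apply hz
        push_cast
        linear_combination h1 - hstep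
      · rw [hstep] at h2
        have h2' : (j : ZMod N) + 2 = 0 := by push_cast at h2; linear_combination h2
        have h3 : ((j + 2 : ℕ) : ZMod N) = 0 := by push_cast; exact h2'
        have : (j : ZMod N) = 0 := by linear_combination h1
        have h4 : ((2 : ℕ) : ZMod N) = 0 := by push_cast; linear_combination h2' - this
        rw [ZMod.natCast_eq_zero_iff] at h4
        have := Nat.le_of_dvd (by norm_num) h4
        omega

/-- A cycle can be enumerated by natural numbers so as to begin and to end at the two ends of a
given edge. -/
theorem exists_enumeration (hN : 3 ≤ N) (h : IsHamCycle N H) {a b : V} (hab : H.Adj a b) :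
    ∃ (w : ℕ → V) (pos : V → ℕ), (∀ x, pos x < N) ∧ (∀ x, w (pos x) = x) ∧
      (∀ k, k < N → pos (w k) = k) ∧ (∀ k, H.Adj (w k) (w (k + 1))) ∧ w 0 = b ∧ w (N - 1) = a ∧
      w N = w 0 := by
  obtain ⟨e, he⟩ := h
  have : NeZero N := ⟨by omega⟩
  have hN1 : ((N - 1 : ℕ) : ZMod N) = -1 := by
    rw [Nat.cast_sub (by omega)]
    simp
  rcases (he a b).mp hab with hs | hs
  · refine ⟨fun k => e.symm (e b + k), fun x => (e x - e b).val, fun x => ZMod.val_lt _,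
      fun x => by simp, fun k hk => ?_, fun k => ?_, by simp, ?_, by simp⟩
    · simp [ZMod.val_natCast, Nat.mod_eq_of_lt hk]
    · rw [he]
      left
      simp [add_assoc]
    · simp only [hN1, hs]
      simp
  · refine ⟨fun k => e.symm (e b - k), fun x => (e b - e x).val, fun x => ZMod.val_lt _,
      fun x => by simp, fun k hk => ?_, fun k => ?_, by simp, ?_, by simp⟩
    · simp [ZMod.val_natCast, Nat.mod_eq_of_lt hk]
    · rw [he]
      right
      simp only [Equiv.apply_symm_apply]
      push_cast
      ring
    · simp only [hN1]
      rw [Equiv.symm_apply_eq, hs]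
      ring

end IsHamCycle

/-! ### Edge partitions, Hamilton decompositions and hooks -/

/-- The graphs `K i` partition the edges of `G`. -/
structure EdgePartition {V κ : Type*} (G : SimpleGraph V) (K : κ → SimpleGraph V) : Prop where
  le : ∀ i, K i ≤ G
  existsUnique : ∀ ⦃x y⦄, G.Adj x y → ∃! i, (K i).Adj x y

theorem EdgePartition.eq_of_adj {V κ : Type*} {G : SimpleGraph V} {K : κ → SimpleGraph V}
    (h : EdgePartition G K) {x y : V} {i j : κ} (hi : (K i).Adj x y) (hj : (K j).Adj x y) :
    i = j :=
  (h.existsUnique (h.le i hi)).unique hi hj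

/-- One of the graphs contains a path `p₀ p₁ p₂ p₃` whose ends are joined in another one. -/
def HasHook {V κ : Type*} (K : κ → SimpleGraph V) : Prop :=
  ∃ i j p₀ p₁ p₂ p₃, i ≠ j ∧ p₀ ≠ p₂ ∧ p₁ ≠ p₃ ∧ (K i).Adj p₀ p₁ ∧ (K i).Adj p₁ p₂ ∧
    (K i).Adj p₂ p₃ ∧ (K j).Adj p₀ p₃

/-- `G` is the edge-disjoint union of Hamilton cycles indexed by `κ`. -/
def HamDecomposable {V : Type*} (κ : Type*) (N : ℕ) (G : SimpleGraph V) : Prop :=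
  ∃ K : κ → SimpleGraph V, EdgePartition G K ∧ ∀ i, IsHamCycle N (K i)

/-- A Hamilton decomposition with a hook. -/
def HookDecomposable {V : Type*} (κ : Type*) (N : ℕ) (G : SimpleGraph V) : Prop :=
  ∃ K : κ → SimpleGraph V, EdgePartition G K ∧ (∀ i, IsHamCycle N (K i)) ∧ HasHook K

theorem HookDecomposable.hamDecomposable {V κ : Type*} {N : ℕ} {G : SimpleGraph V}
    (h : HookDecomposable κ N G) : HamDecomposable κ N G := by
  obtain ⟨K, hK, hc, _⟩ := h
  exact ⟨K, hK, hc⟩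

theorem IsHamCycle.comap {V W : Type*} {N : ℕ} {H : SimpleGraph V} (h : IsHamCycle N H)
    (f : W ≃ V) : IsHamCycle N (H.comap f) := by
  obtain ⟨e, he⟩ := h
  exact ⟨f.trans e, fun x y => by simp [he]⟩

theorem EdgePartition.comap {V W κ : Type*} {G : SimpleGraph V} {G' : SimpleGraph W}
    {K : κ → SimpleGraph V} (h : EdgePartition G K) (f : G' ≃g G) :
    EdgePartition G' (fun i => (K i).comap f) where
  le i _ _ hxy := f.map_rel_iff.mp (h.le i hxy)
  existsUnique _ _ hxy := h.existsUnique (f.map_rel_iff.mpr hxy)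

theorem HamDecomposable.of_iso {V W κ : Type*} {N : ℕ} {G : SimpleGraph V} {G' : SimpleGraph W}
    (h : HamDecomposable κ N G) (f : G' ≃g G) : HamDecomposable κ N G' := by
  obtain ⟨K, hK, hc⟩ := h
  exact ⟨_, hK.comap f, fun i => (hc i).comap f.toEquiv⟩

theorem HookDecomposable.of_iso {V W κ : Type*} {N : ℕ} {G : SimpleGraph V} {G' : SimpleGraph W}
    (h : HookDecomposable κ N G) (f : G' ≃g G) : HookDecomposable κ N G' := by
  obtain ⟨K, hK, hc, i, j, p₀, p₁, p₂, p₃, hij, h02, h13, h01, h12, h23, h03⟩ := h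
  refine ⟨_, hK.comap f, fun i => (hc i).comap f.toEquiv, i, j, f.symm p₀, f.symm p₁, f.symm p₂,
    f.symm p₃, hij, ?_, ?_, ?_, ?_, ?_, ?_⟩ <;> simpa

theorem HookDecomposable.reindex {V κ κ' : Type*} {N : ℕ} {G : SimpleGraph V}
    (h : HookDecomposable κ N G) (σ : κ' ≃ κ) : HookDecomposable κ' N G := by
  obtain ⟨K, hK, hc, i, j, p₀, p₁, p₂, p₃, hij, h02, h13, h01, h12, h23, h03⟩ := h
  refine ⟨fun i => K (σ i), ⟨fun i => hK.le _, fun x y hxy => ?_⟩, fun i => hc _,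
    σ.symm i, σ.symm j, p₀, p₁, p₂, p₃, by simpa, h02, h13, ?_, ?_, ?_, ?_⟩
  · obtain ⟨i, hi, hu⟩ := hK.existsUnique hxy
    refine ⟨σ.symm i, by simpa using hi, fun j hj => ?_⟩
    rw [Equiv.eq_symm_apply]
    exact hu _ hj
  all_goals simpa

/-! ### The torus, and the product of a graph with itself -/

/-- The successor map of a Hamilton cycle in the torus `ZMod N × ZMod N`: walk along the second
coordinate, leaving each row `X` at `Y = -1 - X`. -/
def torusNext {N : ℕ} (p : ZMod N × ZMod N) : ZMod N × ZMod N :=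
  if p.2 = -1 - p.1 then (p.1 + 1, p.2) else (p.1, p.2 + 1)

/-- The Hamilton cycle of the torus traced by `torusNext`. -/
def torusCycle (N : ℕ) : SimpleGraph (ZMod N × ZMod N) :=
  SimpleGraph.fromRel fun p q => q = torusNext p

theorem natCast_ne_zero_of_lt {N k : ℕ} (h0 : 0 < k) (hk : k < N) : (k : ZMod N) ≠ 0 := by
  rw [Ne, ZMod.natCast_eq_zero_iff]
  exact Nat.not_dvd_of_pos_of_lt h0 hk

theorem zmod_one_ne_zero {N : ℕ} (hN : 3 ≤ N) : (1 : ZMod N) ≠ 0 := by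
  simpa using natCast_ne_zero_of_lt (N := N) (k := 1) (by norm_num) (by omega)

theorem zmod_two_ne_zero {N : ℕ} (hN : 3 ≤ N) : (2 : ZMod N) ≠ 0 := by
  simpa using natCast_ne_zero_of_lt (N := N) (k := 2) (by norm_num) (by omega)

theorem torusNext_ne {N : ℕ} (hN : 3 ≤ N) (p : ZMod N × ZMod N) : p ≠ torusNext p := by
  have h1 := zmod_one_ne_zero hN
  obtain ⟨X, Y⟩ := p
  unfold torusNext
  split_ifs <;> simp [h1]

theorem torusCycle_adj {N : ℕ} (hN : 3 ≤ N) (p q : ZMod N × ZMod N) :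
    (torusCycle N).Adj p q ↔ q = torusNext p ∨ p = torusNext q := by
  unfold torusCycle
  rw [fromRel_adj]
  constructor
  · exact fun h => h.2
  · rintro (rfl | rfl)
    · exact ⟨torusNext_ne hN p, Or.inl rfl⟩
    · exact ⟨(torusNext_ne hN q).symm, Or.inr rfl⟩

theorem torusCycle_adj_snd {N : ℕ} (hN : 3 ≤ N) (X Y Y' : ZMod N) :
    (torusCycle N).Adj (X, Y) (X, Y') ↔
      Y' = Y + 1 ∧ Y ≠ -1 - X ∨ Y = Y' + 1 ∧ Y' ≠ -1 - X := by
  have h1 := zmod_one_ne_zero hN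
  rw [torusCycle_adj hN]
  unfold torusNext
  refine or_congr ?_ ?_
  · by_cases h : Y = -1 - X <;> simp [h, h1]
  · by_cases h : Y' = -1 - X <;> simp [h, h1]

theorem torusCycle_adj_fst {N : ℕ} (hN : 3 ≤ N) (X X' Y : ZMod N) :
    (torusCycle N).Adj (X, Y) (X', Y) ↔
      X' = X + 1 ∧ Y = -1 - X ∨ X = X' + 1 ∧ Y = -1 - X' := by
  have h1 := zmod_one_ne_zero hN
  rw [torusCycle_adj hN]
  unfold torusNext
  refine or_congr ?_ ?_
  · by_cases h : Y = -1 - X <;> simp [h, h1]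
  · by_cases h : Y = -1 - X' <;> simp [h, h1]

theorem torusCycle_adj_eq {N : ℕ} (hN : 3 ≤ N) {p q : ZMod N × ZMod N}
    (h : (torusCycle N).Adj p q) : p.1 = q.1 ∨ p.2 = q.2 := by
  rw [torusCycle_adj hN] at h
  unfold torusNext at h
  grind

theorem torusCycle_twoRegular {N : ℕ} (hN : 3 ≤ N) : TwoRegular (torusCycle N) := by
  have h1 := zmod_one_ne_zero hN
  have h2 := zmod_two_ne_zero hN
  rintro ⟨X, Y⟩
  -- The second neighbour is the predecessor. Row `X - 1` is left at `Y = -1 - (X - 1) = -X`, so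
  -- this is where row `X` is entered.
  refine ⟨torusNext (X, Y), if Y = -X then (X - 1, Y) else (X, Y - 1), ?_, fun q => ?_⟩
  · unfold torusNext
    intro h
    split_ifs at h with ha hb hb <;> simp only [Prod.mk.injEq] at h
    · apply h1; linear_combination ha - hb
    · apply h1; linear_combination h.1
    · apply h1; linear_combination h.2
    · apply h2; linear_combination h.2
  · rw [torusCycle_adj hN]
    refine or_congr_right ?_
    obtain ⟨X', Y'⟩ := q
    unfold torusNext
    split_ifs with ha hb hb <;> simp only [Prod.mk.injEq]
    · constructor
      · rintro ⟨hx, hy⟩; exact ⟨by rw [hx]; ring, hy.symm⟩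
      · rintro ⟨hx, hy⟩; exact ⟨by rw [hx]; ring, hy.symm⟩
    · simp only at ha
      constructor
      · rintro ⟨hx, hy⟩; exact (hb (by rw [hy, ha, hx]; ring)).elim
      · rintro ⟨hx, hy⟩; exact (hb (by linear_combination ha - hy - hx)).elim
    · simp only at ha
      constructor
      · rintro ⟨hx, hy⟩; exact (ha (by rw [← hx]; linear_combination hb - hy)).elim
      · rintro ⟨hx, hy⟩; exact (ha (by rw [hx, hy, hb]; ring)).elim
    · constructor
      · rintro ⟨hx, hy⟩; exact ⟨hx.symm, by rw [hy]; ring⟩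
      · rintro ⟨hx, hy⟩; exact ⟨hx.symm, by rw [hy]; ring⟩

/-- Row `X` is traversed as a path from `(X, -X)` to `(X, -1 - X)`, and the exit there leads to the
starting point of row `X + 1`. -/
theorem torusCycle_connected {N : ℕ} (hN : 3 ≤ N) : (torusCycle N).Connected := by
  have : NeZero N := ⟨by omega⟩
  have hrow : ∀ (X : ZMod N) (j : ℕ), j < N →
      (torusCycle N).Reachable (X, -X) (X, -X + j) := by
    intro X j
    induction j with
    | zero => intro _; simp
    | succ j ih =>
      intro hj
      refine (ih (by omega)).trans (Adj.reachable ?_)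
      rw [torusCycle_adj_snd hN]
      left
      refine ⟨by push_cast; ring, fun h => ?_⟩
      apply natCast_ne_zero_of_lt (N := N) (k := j + 1) (by omega) hj
      push_cast
      linear_combination h
  have hrow' : ∀ X Y : ZMod N, (torusCycle N).Reachable (X, -X) (X, Y) := by
    intro X Y
    have := hrow X (Y + X).val (ZMod.val_lt _)
    rwa [ZMod.natCast_val, ZMod.cast_id, neg_add_eq_sub, add_sub_cancel_right] at this
  have hroot : ∀ j : ℕ, (torusCycle N).Reachable (0, 0) ((j : ZMod N), -(j : ZMod N)) := by
    intro j
    induction j with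
    | zero => simp
    | succ j ih =>
      refine (ih.trans (hrow' j (-1 - j))).trans (Adj.reachable ?_)
      have : (-((j + 1 : ℕ) : ZMod N)) = -1 - j := by push_cast; ring
      rw [this, torusCycle_adj_fst hN]
      left
      simp
  have hall : ∀ p, (torusCycle N).Reachable (0, 0) p := by
    rintro ⟨X, Y⟩
    have := hroot X.val
    rw [ZMod.natCast_val, ZMod.cast_id] at this
    exact this.trans (hrow' X Y)
  exact ⟨fun p q => (hall p).symm.trans (hall q)⟩

theorem torusCycle_isHamCycle {N : ℕ} (hN : 3 ≤ N) : IsHamCycle (N * N) (torusCycle N) := by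
  have : NeZero N := ⟨by omega⟩
  have := (torusCycle_twoRegular hN).isHamCycle (torusCycle_connected hN)
  rwa [Fintype.card_prod, ZMod.card] at this

/-- The staircase in `K i □ K i` omits the second-coordinate edges that start on the antidiagonal `X
+ Y = -1` and uses only those first-coordinate edges that start on it. This condition is symmetric
in `X` and `Y`, so the complement of the staircase is its transpose, again a Hamilton cycle. -/
theorem HookDecomposable.boxProd_self {V κ : Type*} {N : ℕ} (hN : 4 ≤ N) {G : SimpleGraph V}
    (h : HookDecomposable κ N G) : HookDecomposable (κ × Bool) (N * N) (G □ G) := by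
  classical
  have hN3 : 3 ≤ N := by omega
  have : NeZero N := ⟨by omega⟩
  obtain ⟨K, hK, hc, i, j, p₀, p₁, p₂, p₃, hij, h02, h13, h01, h12, h23, h03⟩ := h
  choose e he using hc
  have h1 := zmod_one_ne_zero hN3
  have h2 := zmod_two_ne_zero hN3
  let K' : κ × Bool → SimpleGraph (V × V) := fun c =>
    if c.2 then (torusCycle N).comap (fun p => (e c.1 p.2, e c.1 p.1))
    else (torusCycle N).comap (fun p => (e c.1 p.1, e c.1 p.2))
  have snd_false : ∀ i x y y', (K' (i, false)).Adj (x, y) (x, y') ↔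
      e i y' = e i y + 1 ∧ e i y ≠ -1 - e i x ∨ e i y = e i y' + 1 ∧ e i y' ≠ -1 - e i x :=
    fun i x y y' => torusCycle_adj_snd hN3 _ _ _
  have snd_true : ∀ i x y y', (K' (i, true)).Adj (x, y) (x, y') ↔
      e i y' = e i y + 1 ∧ e i x = -1 - e i y ∨ e i y = e i y' + 1 ∧ e i x = -1 - e i y' :=
    fun i x y y' => torusCycle_adj_fst hN3 _ _ _
  have hswap : ∀ i : κ, ∀ x y : V, e i x = -1 - e i y ↔ e i y = -1 - e i x := by
    intro i x y
    constructor <;> intro h <;> linear_combination h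
  -- An edge has only one orientation along its cycle; the reverse would give `2 = 0`.
  have hexcl : ∀ i x y, e i y = e i x + 1 → e i x = e i y + 1 → False := by
    intro i x y ha hb
    apply h2
    linear_combination -ha - hb
  have hsnd : ∀ i x y y', (K i).Adj y y' → ∃! b, (K' (i, b)).Adj (x, y) (x, y') := by
    intro i x y y' hy
    rcases (he i y y').mp hy with ha | ha
    · by_cases hb : e i y = -1 - e i x
      · refine ⟨true, (snd_true _ _ _ _).mpr (Or.inl ⟨ha, (hswap _ _ _).mpr hb⟩), ?_⟩
        rintro (_ | _) hc
        · rw [snd_false] at hc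
          have := hexcl i y y' ha
          tauto
        · rfl
      · refine ⟨false, (snd_false _ _ _ _).mpr (Or.inl ⟨ha, hb⟩), ?_⟩
        rintro (_ | _) hc
        · rfl
        · rw [snd_true, hswap] at hc
          have := hexcl i y y' ha
          tauto
    · by_cases hb : e i y' = -1 - e i x
      · refine ⟨true, (snd_true _ _ _ _).mpr (Or.inr ⟨ha, (hswap _ _ _).mpr hb⟩), ?_⟩
        rintro (_ | _) hc
        · rw [snd_false] at hc
          have := hexcl i y' y ha
          tauto
        · rfl
      · refine ⟨false, (snd_false _ _ _ _).mpr (Or.inr ⟨ha, hb⟩), ?_⟩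
        rintro (_ | _) hc
        · rfl
        · rw [snd_true, hswap i x y'] at hc
          have := hexcl i y' y ha
          tauto
  have hfst : ∀ i x x' y, (K i).Adj x x' → ∃! b, (K' (i, b)).Adj (x, y) (x', y) := by
    intro i x x' y hx
    obtain ⟨b, hb, hu⟩ := hsnd i y x x' hx
    refine ⟨!b, ?_, fun b' hb' => ?_⟩
    · cases b
      · exact hb
      · exact hb
    · have := hu (!b') (by cases b' <;> exact hb')
      rw [← this, Bool.not_not]
  have hproj_snd : ∀ c x y y', (K' c).Adj (x, y) (x, y') → (K c.1).Adj y y' := by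
    rintro ⟨i, _ | _⟩ x y y' hc
    · rw [snd_false] at hc
      rw [he]
      tauto
    · rw [snd_true] at hc
      rw [he]
      tauto
  have hproj_fst : ∀ c x x' y, (K' c).Adj (x, y) (x', y) → (K c.1).Adj x x' := by
    rintro ⟨i, _ | _⟩ x x' y hc
    · exact hproj_snd (i, true) y x x' hc
    · exact hproj_snd (i, false) y x x' hc
  have hdiag : ∀ c p q, (K' c).Adj p q → p.1 = q.1 ∨ p.2 = q.2 := by
    rintro ⟨i, _ | _⟩ p q hc
    · have := torusCycle_adj_eq hN3 hc
      simpa using this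
    · have := torusCycle_adj_eq hN3 hc
      simp only [EmbeddingLike.apply_eq_iff_eq] at this
      exact this.symm
  refine ⟨K', ⟨?_, ?_⟩, ?_, ?_⟩
  · rintro c ⟨x, y⟩ ⟨x', y'⟩ hadj
    rw [boxProd_adj]
    rcases hdiag _ _ _ hadj with heq | heq
    · obtain rfl : x = x' := heq
      exact Or.inr ⟨hK.le _ (hproj_snd _ _ _ _ hadj), rfl⟩
    · obtain rfl : y = y' := heq
      exact Or.inl ⟨hK.le _ (hproj_fst _ _ _ _ hadj), rfl⟩
  · rintro ⟨x, y⟩ ⟨x', y'⟩ hadj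
    rw [boxProd_adj] at hadj
    rcases hadj with ⟨hadj, heq⟩ | ⟨hadj, heq⟩
    · obtain rfl : y = y' := heq
      obtain ⟨i, hi, hu⟩ := hK.existsUnique hadj
      obtain ⟨b, hb, hub⟩ := hfst i x x' y hi
      refine ⟨(i, b), hb, ?_⟩
      rintro ⟨i', b'⟩ hc
      obtain rfl := hu i' (hproj_fst _ _ _ _ hc)
      rw [hub b' hc]
    · obtain rfl : x = x' := heq
      obtain ⟨i, hi, hu⟩ := hK.existsUnique hadj
      obtain ⟨b, hb, hub⟩ := hsnd i x y y' hi
      refine ⟨(i, b), hb, ?_⟩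
      rintro ⟨i', b'⟩ hc
      obtain rfl := hu i' (hproj_snd _ _ _ _ hc)
      rw [hub b' hc]
  · rintro ⟨i, _ | _⟩
    · exact (torusCycle_isHamCycle hN3).comap ((e i).prodCongr (e i))
    · exact (torusCycle_isHamCycle hN3).comap
        ((Equiv.prodComm V V).trans ((e i).prodCongr (e i)))
  -- A given edge `yy'` of `K i` is missed by the staircase above only one `x`. Above an `x`
  -- avoiding the three exceptions, which exists as `4 ≤ N`, the old hook reappears inside the fibre
  -- `{x} × V`.
  · have hmiss : ∀ y y', (K i).Adj y y' →
        ∃ x₀, ∀ x, x ≠ x₀ → (K' (i, false)).Adj (x, y) (x, y') := by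
      intro y y' hy
      rcases (he i y y').mp hy with ha | ha
      · refine ⟨(e i).symm (-1 - e i y), fun x hx => (snd_false _ _ _ _).mpr (Or.inl ⟨ha, ?_⟩)⟩
        rintro hb
        apply hx
        rw [Equiv.eq_symm_apply, hb]
        ring
      · refine ⟨(e i).symm (-1 - e i y'), fun x hx => (snd_false _ _ _ _).mpr (Or.inr ⟨ha, ?_⟩)⟩
        rintro hb
        apply hx
        rw [Equiv.eq_symm_apply, hb]
        ring
    obtain ⟨x₁, hx₁⟩ := hmiss _ _ h01
    obtain ⟨x₂, hx₂⟩ := hmiss _ _ h12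
    obtain ⟨x₃, hx₃⟩ := hmiss _ _ h23
    let _ : Fintype V := Fintype.ofEquiv _ (e i).symm
    have hcard : Fintype.card V = N := by rw [Fintype.card_congr (e i), ZMod.card]
    obtain ⟨x, hx⟩ : ∃ x, x ∉ ({x₁, x₂, x₃} : Finset V) := by
      by_contra hall
      push Not at hall
      have := Finset.card_le_card (fun x _ => hall x : Finset.univ ⊆ ({x₁, x₂, x₃} : Finset V))
      rw [Finset.card_univ, hcard] at this
      have := Finset.card_le_three (a := x₁) (b := x₂) (c := x₃)
      omega
    simp only [Finset.mem_insert, Finset.mem_singleton, not_or] at hx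
    obtain ⟨b, hb, _⟩ := hsnd j x p₀ p₃ h03
    refine ⟨(i, false), (j, b), (x, p₀), (x, p₁), (x, p₂), (x, p₃), ?_, ?_, ?_, hx₁ x hx.1,
      hx₂ x hx.2.1, hx₃ x hx.2.2, hb⟩
    · simp [hij]
    · simp [h02]
    · simp [h13]

/-! ### Switching squares in the product with a 4-cycle -/

/-- The 4-cycle on `Fin 4`. -/
def fourCycle : SimpleGraph (Fin 4) where
  Adj l l' := l' = l + 1 ∨ l = l' + 1
  symm := ⟨fun _ _ h => h.symm⟩
  loopless := ⟨by decide⟩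

instance : DecidableRel fourCycle.Adj := fun l l' =>
  inferInstanceAs (Decidable (l' = l + 1 ∨ l = l' + 1))

/-- A system of switches for the product of `⋃ K i` with a 4-cycle: `S i x y l` says that the edge
`xy` of `K i` trades its copies in the layers `l`, `l + 1` for the vertical edges above `x`, `y`
between these layers. -/
structure SwitchSystem {V κ : Type*} (K : κ → SimpleGraph V) (S : κ → V → V → Fin 4 → Prop) :
    Prop where
  adj : ∀ {i x y l}, S i x y l → (K i).Adj x y
  symm : ∀ {i x y l}, S i x y l → S i y x l
  -- These two conditions make the switched squares edge-disjoint: `unique` for the vertical sides,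
  -- `level` for the horizontal ones.
  unique : ∀ {i j x y z l}, S i x y l → S j x z l → y = z
  level : ∀ {i x y l l'}, S i x y l → S i x y l' → l = l'

/-- The layers of `H` after switching along `S`. -/
def switchedLayers {V : Type*} (H : SimpleGraph V) (S : V → V → Fin 4 → Prop)
    (hS : ∀ {x y l}, S x y l → S y x l) : SimpleGraph (V × Fin 4) where
  Adj p q := (p.2 = q.2 ∧ H.Adj p.1 q.1 ∧ ¬ S p.1 q.1 p.2 ∧ ¬ S p.1 q.1 (p.2 - 1)) ∨
    (p.1 = q.1 ∧ q.2 = p.2 + 1 ∧ ∃ z, S p.1 z p.2) ∨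
    (p.1 = q.1 ∧ p.2 = q.2 + 1 ∧ ∃ z, S p.1 z q.2)
  symm := ⟨by
    rintro ⟨x, l⟩ ⟨y, l'⟩ (⟨rfl, h, h1, h2⟩ | ⟨rfl, h, hz⟩ | ⟨rfl, h, hz⟩)
    · exact Or.inl ⟨rfl, h.symm, fun h' => h1 (hS h'), fun h' => h2 (hS h')⟩
    · exact Or.inr (Or.inr ⟨rfl, h, hz⟩)
    · exact Or.inr (Or.inl ⟨rfl, h, hz⟩)⟩
  loopless := ⟨by
    rintro ⟨x, l⟩ (⟨_, h, _⟩ | ⟨_, h, _⟩ | ⟨_, h, _⟩)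
    · exact h.ne rfl
    · revert h; simp
    · revert h; simp⟩

/-- The columns `{x} × Fin 4` after switching along `S`. -/
def switchedColumns {V : Type*} (S : V → V → Fin 4 → Prop)
    (hS : ∀ {x y l}, S x y l → S y x l) (hne : ∀ {x l}, ¬ S x x l) :
    SimpleGraph (V × Fin 4) where
  Adj p q := (p.2 = q.2 ∧ (S p.1 q.1 p.2 ∨ S p.1 q.1 (p.2 - 1))) ∨
    (p.1 = q.1 ∧ q.2 = p.2 + 1 ∧ ∀ z, ¬ S p.1 z p.2) ∨
    (p.1 = q.1 ∧ p.2 = q.2 + 1 ∧ ∀ z, ¬ S p.1 z q.2)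
  symm := ⟨by
    rintro ⟨x, l⟩ ⟨y, l'⟩ (⟨rfl, h⟩ | ⟨rfl, h, hz⟩ | ⟨rfl, h, hz⟩)
    · exact Or.inl ⟨rfl, h.imp (fun h => hS h) (fun h => hS h)⟩
    · exact Or.inr (Or.inr ⟨rfl, h, hz⟩)
    · exact Or.inr (Or.inl ⟨rfl, h, hz⟩)⟩
  loopless := ⟨by
    rintro ⟨x, l⟩ (⟨_, h⟩ | ⟨_, h, _⟩ | ⟨_, h, _⟩)
    · exact h.elim (fun h => hne h) (fun h => hne h)
    · revert h; simp
    · revert h; simp⟩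

theorem fin4_add_one_ne_sub_one (l : Fin 4) : l + 1 ≠ l - 1 := by revert l; decide

theorem fin4_sub_one_ne (l : Fin 4) : l - 1 ≠ l := by revert l; decide

theorem fin4_add_one_ne (l : Fin 4) : l + 1 ≠ l := by revert l; decide

theorem fin4_eq_add_one_iff (l l' : Fin 4) : l = l' + 1 ↔ l' = l - 1 := by
  revert l l'; decide

theorem switchedLayers_twoRegular {V : Type*} {H : SimpleGraph V} {S : V → V → Fin 4 → Prop}
    (hS : ∀ {x y l}, S x y l → S y x l) (hadj : ∀ {x y l}, S x y l → H.Adj x y)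
    (hu : ∀ {x y z l}, S x y l → S x z l → y = z)
    (hl : ∀ {x y l l'}, S x y l → S x y l' → l = l') (hH : TwoRegular H) :
    TwoRegular (switchedLayers H S hS) := by
  classical
  rintro ⟨x, l⟩
  obtain ⟨a, b, hab, hn⟩ := hH x
  -- `φ` records what replaces the edge from `(x, l)` to `(z, l)`: the vertical edge up or down if
  -- that edge was switched away, itself otherwise. The neighbours of `(x, l)` are the images of the
  -- two `H`-neighbours of `x`.
  let φ : V → V × Fin 4 := fun z =>
    if S x z l then (x, l + 1) else if S x z (l - 1) then (x, l - 1) else (z, l)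
  have hφ1 : ∀ z, S x z l → φ z = (x, l + 1) := fun z h => if_pos h
  have hφ2 : ∀ z, S x z (l - 1) → φ z = (x, l - 1) := fun z h => by
    have : ¬ S x z l := fun h' => fin4_sub_one_ne l (hl h h')
    simp [φ, h, this]
  have hφ3 : ∀ z, ¬ S x z l → ¬ S x z (l - 1) → φ z = (z, l) := fun z h h' => by
    simp [φ, h, h']
  have key : ∀ q, (switchedLayers H S hS).Adj (x, l) q ↔ ∃ z, H.Adj x z ∧ q = φ z := by
    rintro ⟨y, l'⟩
    constructor
    · rintro (⟨h, h1, h2, h3⟩ | ⟨h, h1, z, hz⟩ | ⟨h, h1, z, hz⟩)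
      · simp only at h h1 h2 h3
        subst h
        exact ⟨y, h1, (hφ3 _ h2 h3).symm⟩
      · simp only at h h1 hz
        subst h h1
        exact ⟨z, hadj hz, (hφ1 _ hz).symm⟩
      · simp only at h h1 hz
        rw [fin4_eq_add_one_iff] at h1
        subst h h1
        exact ⟨z, hadj hz, (hφ2 _ hz).symm⟩
    · rintro ⟨z, hz, hq⟩
      by_cases h1 : S x z l
      · rw [hφ1 z h1] at hq
        rw [hq]
        exact Or.inr (Or.inl ⟨rfl, rfl, z, h1⟩)
      · by_cases h2 : S x z (l - 1)
        · rw [hφ2 z h2] at hq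
          rw [hq]
          exact Or.inr (Or.inr ⟨rfl, by simp, z, h2⟩)
        · rw [hφ3 z h1 h2] at hq
          rw [hq]
          exact Or.inl ⟨rfl, hz, h1, h2⟩
  have hne : ∀ (y : Fin 4) (z : V) (l' : Fin 4), H.Adj x z → (x, l') ≠ (z, y) := fun y z l' h heq =>
    h.ne (congrArg Prod.fst heq)
  refine ⟨φ a, φ b, ?_, fun q => ?_⟩
  · have ha : H.Adj x a := (hn a).mpr (Or.inl rfl)
    have hb : H.Adj x b := (hn b).mpr (Or.inr rfl)
    have h4 := fin4_add_one_ne_sub_one l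
    intro heq
    by_cases h1 : S x a l
    · rw [hφ1 _ h1] at heq
      by_cases h1' : S x b l
      · exact hab (hu h1 h1')
      · by_cases h2' : S x b (l - 1)
        · rw [hφ2 _ h2'] at heq
          exact h4 (congrArg Prod.snd heq)
        · rw [hφ3 _ h1' h2'] at heq
          exact hne _ _ _ hb heq
    · by_cases h2 : S x a (l - 1)
      · rw [hφ2 _ h2] at heq
        by_cases h1' : S x b l
        · rw [hφ1 _ h1'] at heq
          exact h4 (congrArg Prod.snd heq).symm
        · by_cases h2' : S x b (l - 1)
          · exact hab (hu h2 h2')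
          · rw [hφ3 _ h1' h2'] at heq
            exact hne _ _ _ hb heq
      · rw [hφ3 _ h1 h2] at heq
        by_cases h1' : S x b l
        · rw [hφ1 _ h1'] at heq
          exact hne _ _ _ ha heq.symm
        · by_cases h2' : S x b (l - 1)
          · rw [hφ2 _ h2'] at heq
            exact hne _ _ _ ha heq.symm
          · rw [hφ3 _ h1' h2'] at heq
            exact hab (congrArg Prod.fst heq)
  · rw [key]
    constructor
    · rintro ⟨z, hz, rfl⟩
      rcases (hn z).mp hz with rfl | rfl
      · exact Or.inl rfl
      · exact Or.inr rfl
    · rintro (rfl | rfl)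
      · exact ⟨a, (hn a).mpr (Or.inl rfl), rfl⟩
      · exact ⟨b, (hn b).mpr (Or.inr rfl), rfl⟩

theorem switchedColumns_twoRegular {V : Type*} {S : V → V → Fin 4 → Prop}
    (hS : ∀ {x y l}, S x y l → S y x l) (hne : ∀ {x l}, ¬ S x x l)
    (hu : ∀ {x y z l}, S x y l → S x z l → y = z)
    (hl : ∀ {x y l l'}, S x y l → S x y l' → l = l') :
    TwoRegular (switchedColumns S hS hne) := by
  rintro ⟨x, l⟩
  -- Each of the two vertical edges at `(x, l)`, of level `m = l` upwards and `m = l - 1` downwards,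
  -- either survives or is replaced by the horizontal side of the square that contains it.
  have hpart : ∀ m l', ∃ q : V × Fin 4, (∀ z, S x z m → q = (z, l)) ∧
      ((∀ z, ¬ S x z m) → q = (x, l')) := by
    intro m l'
    by_cases h : ∃ z, S x z m
    · obtain ⟨z, hz⟩ := h
      exact ⟨(z, l), fun z' hz' => by rw [hu hz hz'], fun h => (h z hz).elim⟩
    · push Not at h
      exact ⟨(x, l'), fun z hz => (h z hz).elim, fun _ => rfl⟩
  obtain ⟨a, ha1, ha2⟩ := hpart l (l + 1)
  obtain ⟨b, hb1, hb2⟩ := hpart (l - 1) (l - 1)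
  refine ⟨a, b, ?_, ?_⟩
  · rintro rfl
    by_cases h : ∃ z, S x z l
    · obtain ⟨z, hz⟩ := h
      by_cases h' : ∃ z, S x z (l - 1)
      · obtain ⟨z', hz'⟩ := h'
        have : (z, l) = (z', l) := (ha1 z hz).symm.trans (hb1 z' hz')
        obtain rfl : z = z' := congrArg Prod.fst this
        exact fin4_sub_one_ne l (hl hz' hz)
      · push Not at h'
        have : (z, l) = (x, l - 1) := (ha1 z hz).symm.trans (hb2 h')
        exact fin4_sub_one_ne l (congrArg Prod.snd this).symm
    · push Not at h
      by_cases h' : ∃ z, S x z (l - 1)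
      · obtain ⟨z', hz'⟩ := h'
        have : (z', l) = (x, l + 1) := (hb1 z' hz').symm.trans (ha2 h)
        exact fin4_add_one_ne l (congrArg Prod.snd this).symm
      · push Not at h'
        have : (x, l - 1) = (x, l + 1) := (hb2 h').symm.trans (ha2 h)
        exact fin4_add_one_ne_sub_one l (congrArg Prod.snd this).symm
  · rintro ⟨y, l'⟩
    constructor
    · rintro (⟨h, h1 | h1⟩ | ⟨h, h1, hz⟩ | ⟨h, h1, hz⟩)
      · simp only at h h1
        subst h
        exact Or.inl (ha1 _ h1).symm
      · simp only at h h1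
        subst h
        exact Or.inr (hb1 _ h1).symm
      · simp only at h h1 hz
        subst h h1
        exact Or.inl (ha2 hz).symm
      · simp only at h h1 hz
        rw [fin4_eq_add_one_iff] at h1
        subst h h1
        exact Or.inr (hb2 hz).symm
    · rintro (h | h)
      · by_cases h' : ∃ z, S x z l
        · obtain ⟨z, hz⟩ := h'
          rw [h, ha1 z hz]
          exact Or.inl ⟨rfl, Or.inl hz⟩
        · push Not at h'
          rw [h, ha2 h']
          exact Or.inr (Or.inl ⟨rfl, rfl, h'⟩)
      · by_cases h' : ∃ z, S x z (l - 1)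
        · obtain ⟨z, hz⟩ := h'
          rw [h, hb1 z hz]
          exact Or.inl ⟨rfl, Or.inr hz⟩
        · push Not at h'
          rw [h, hb2 h']
          exact Or.inr (Or.inr ⟨rfl, by simp, h'⟩)

namespace SwitchSystem

variable {V κ : Type*} {G : SimpleGraph V} {K : κ → SimpleGraph V} {S : κ → V → V → Fin 4 → Prop}

/-- The switched layers of each `K i`, and the switched columns at index `none`. -/
def graphs (h : SwitchSystem K S) : Option κ → SimpleGraph (V × Fin 4)
  | some i => switchedLayers (K i) (S i) h.symm
  | none => switchedColumns (fun x y l => ∃ i, S i x y l) (fun ⟨i, hi⟩ => ⟨i, h.symm hi⟩)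
      (fun ⟨_, hi⟩ => (h.adj hi).ne rfl)

theorem twoRegular (h : SwitchSystem K S) (hK : EdgePartition G K)
    (h2 : ∀ i, TwoRegular (K i)) (c : Option κ) : TwoRegular (h.graphs c) := by
  cases c with
  | some i => exact switchedLayers_twoRegular (S := S i) h.symm h.adj h.unique h.level (h2 i)
  | none =>
    refine switchedColumns_twoRegular (S := fun x y l => ∃ i, S i x y l) (fun ⟨i, hi⟩ => ⟨i, h.symm hi⟩)
      (fun ⟨_, hi⟩ => (h.adj hi).ne rfl) ?_ ?_
    · rintro x y z l ⟨i, hi⟩ ⟨j, hj⟩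
      exact h.unique hi hj
    · rintro x y l l' ⟨i, hi⟩ ⟨j, hj⟩
      obtain rfl := hK.eq_of_adj (h.adj hi) (h.adj hj)
      exact h.level hi hj

/-- Layers and columns partition the edges of the product, and each switch hands two edges of a
square to the columns in return for the other two. The squares are edge-disjoint, so the trades do
not interfere. -/
theorem edgePartition (h : SwitchSystem K S) (hK : EdgePartition G K) :
    EdgePartition (G □ fourCycle) h.graphs where
  le := by
    rintro (_ | i) ⟨x, l⟩ ⟨y, l'⟩
    · rintro (⟨h1, ⟨i, hi⟩ | ⟨i, hi⟩⟩ | ⟨h1, h2, _⟩ | ⟨h1, h2, _⟩)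
      · exact Or.inl ⟨hK.le i (h.adj hi), h1⟩
      · exact Or.inl ⟨hK.le i (h.adj hi), h1⟩
      · exact Or.inr ⟨Or.inl h2, h1⟩
      · exact Or.inr ⟨Or.inr h2, h1⟩
    · rintro (⟨h1, h2, _⟩ | ⟨h1, h2, _⟩ | ⟨h1, h2, _⟩)
      · exact Or.inl ⟨hK.le i h2, h1⟩
      · exact Or.inr ⟨Or.inl h2, h1⟩
      · exact Or.inr ⟨Or.inr h2, h1⟩
  existsUnique := by
    have hvert : ∀ x l, ∃! c, (h.graphs c).Adj (x, l) (x, l + 1) := by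
      intro x l
      have hl : ∀ l : Fin 4, l ≠ l + 1 + 1 := by decide
      have hsome : ∀ i, (h.graphs (some i)).Adj (x, l) (x, l + 1) ↔ ∃ z, S i x z l := by
        intro i
        constructor
        · rintro (⟨h1, _⟩ | ⟨_, _, hz⟩ | ⟨_, h2, _⟩)
          · exact (fin4_add_one_ne l h1.symm).elim
          · exact hz
          · exact (hl l h2).elim
        · exact fun hz => Or.inr (Or.inl ⟨rfl, rfl, hz⟩)
      have hnone : (h.graphs none).Adj (x, l) (x, l + 1) ↔ ∀ z, ¬ ∃ i, S i x z l := by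
        constructor
        · rintro (⟨h1, _⟩ | ⟨_, _, hz⟩ | ⟨_, h2, _⟩)
          · exact (fin4_add_one_ne l h1.symm).elim
          · exact hz
          · exact (hl l h2).elim
        · exact fun hz => Or.inr (Or.inl ⟨rfl, rfl, hz⟩)
      by_cases hz : ∃ i z, S i x z l
      · obtain ⟨i, z, hz⟩ := hz
        refine ⟨some i, (hsome i).mpr ⟨z, hz⟩, ?_⟩
        rintro (_ | j) hj
        · exact ((hnone.mp hj) z ⟨i, hz⟩).elim
        · obtain ⟨z', hz'⟩ := (hsome j).mp hj
          obtain rfl := h.unique hz hz'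
          rw [hK.eq_of_adj (h.adj hz) (h.adj hz')]
      · push Not at hz
        refine ⟨none, hnone.mpr fun z ⟨i, hi⟩ => hz i z hi, ?_⟩
        rintro (_ | j) hj
        · rfl
        · obtain ⟨z', hz'⟩ := (hsome j).mp hj
          exact (hz j z' hz').elim
    rintro ⟨x, l⟩ ⟨y, l'⟩ (⟨hxy, hl⟩ | ⟨hl | hl, hx⟩)
    · obtain rfl : l = l' := hl
      simp only at hxy
      have hl1 := fin4_add_one_ne l
      have hsome : ∀ i, (h.graphs (some i)).Adj (x, l) (y, l) ↔
          (K i).Adj x y ∧ ¬ S i x y l ∧ ¬ S i x y (l - 1) := by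
        intro i
        constructor
        · rintro (⟨_, h1⟩ | ⟨_, h2, _⟩ | ⟨_, h2, _⟩)
          · exact h1
          · exact (hl1 h2.symm).elim
          · exact (hl1 h2.symm).elim
        · exact fun h1 => Or.inl ⟨rfl, h1⟩
      have hnone : (h.graphs none).Adj (x, l) (y, l) ↔
          (∃ i, S i x y l) ∨ ∃ i, S i x y (l - 1) := by
        constructor
        · rintro (⟨_, h1⟩ | ⟨_, h2, _⟩ | ⟨_, h2, _⟩)
          · exact h1
          · exact (hl1 h2.symm).elim
          · exact (hl1 h2.symm).elim
        · exact fun h1 => Or.inl ⟨rfl, h1⟩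
      obtain ⟨i, hi, hu⟩ := hK.existsUnique hxy
      by_cases hs : S i x y l ∨ S i x y (l - 1)
      · refine ⟨none, hnone.mpr (hs.imp (fun h => ⟨i, h⟩) fun h => ⟨i, h⟩), ?_⟩
        rintro (_ | j) hj
        · rfl
        · rw [hsome] at hj
          obtain rfl := hu j hj.1
          tauto
      · refine ⟨some i, (hsome i).mpr ⟨hi, by tauto, by tauto⟩, ?_⟩
        rintro (_ | j) hj
        · exfalso
          rw [hnone] at hj
          rcases hj with ⟨j, hj⟩ | ⟨j, hj⟩ <;> obtain rfl := hu j (h.adj hj) <;> tauto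
        · rw [hsome] at hj
          rw [hu j hj.1]
    · obtain rfl : x = y := hx
      obtain rfl : l' = l + 1 := hl
      exact hvert x l
    · obtain rfl : x = y := hx
      obtain rfl : l = l' + 1 := hl
      obtain ⟨c, hc, hu⟩ := hvert x l'
      exact ⟨c, hc.symm, fun c' hc' => hu c' hc'.symm⟩

end SwitchSystem

/-! ### Exchange along an alternating 4-cycle -/

/-- Remove the edges `ab`, `cd` from `H` and add the edges `bc`, `da`. -/
def swapEdges {V : Type*} (H : SimpleGraph V) (a b c d : V) (hbc : b ≠ c) (hda : d ≠ a) :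
    SimpleGraph V where
  Adj x y := (H.Adj x y ∧ s(x, y) ≠ s(a, b) ∧ s(x, y) ≠ s(c, d)) ∨
    s(x, y) = s(b, c) ∨ s(x, y) = s(d, a)
  symm := ⟨by
    intro x y h
    rw [Sym2.eq_swap (a := y)]
    exact h.imp_left fun h => ⟨h.1.symm, h.2⟩⟩
  loopless := ⟨by
    rintro x (⟨h, _⟩ | h | h)
    · exact h.ne rfl
    · simp only [Sym2.eq_iff] at h
      grind
    · simp only [Sym2.eq_iff] at h
      grind⟩

theorem swapEdges_twoRegular {V : Type*} {H : SimpleGraph V} {a b c d : V} (hbc : b ≠ c)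
    (hda : d ≠ a) (hac : a ≠ c) (hbd : b ≠ d) (h : TwoRegular H) (hab : H.Adj a b)
    (hcd : H.Adj c d) (hbc' : ¬ H.Adj b c) (hda' : ¬ H.Adj d a) :
    TwoRegular (swapEdges H a b c d hbc hda) := by
  have hab' := hab.ne
  have hcd' := hcd.ne
  -- A corner `v` of the square loses one neighbour `p` and gains a new one `r`; its other neighbour
  -- `q` stays.
  have key : ∀ v p r, H.Adj v p → ¬ H.Adj v r → (∀ y, (s(v, y) = s(a, b) ∨ s(v, y) = s(c, d)) ↔
      y = p) → (∀ y, (s(v, y) = s(b, c) ∨ s(v, y) = s(d, a)) ↔ y = r) →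
      ∃ a₁ b₁, a₁ ≠ b₁ ∧ ∀ y, (swapEdges H a b c d hbc hda).Adj v y ↔ y = a₁ ∨ y = b₁ := by
    intro v p r hp hr h1 h2
    obtain ⟨q, hqp, hq⟩ : ∃ q, q ≠ p ∧ ∀ y, H.Adj v y ↔ y = p ∨ y = q := by
      obtain ⟨a', b', hne, hn⟩ := h v
      rcases (hn p).mp hp with rfl | rfl
      · exact ⟨b', hne.symm, hn⟩
      · exact ⟨a', hne, fun y => (hn y).trans or_comm⟩
    refine ⟨q, r, fun hqr => hr ((hq r).mpr (Or.inr hqr.symm)), fun y => ?_⟩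
    have h1y := h1 y
    have h2y := h2 y
    have hqy := hq y
    change (H.Adj v y ∧ s(v, y) ≠ s(a, b) ∧ s(v, y) ≠ s(c, d)) ∨
      (s(v, y) = s(b, c) ∨ s(v, y) = s(d, a)) ↔ _
    rw [h2y, hqy, ← not_or, h1y]
    constructor
    · tauto
    · rintro (rfl | rfl)
      · exact Or.inl ⟨Or.inr rfl, hqp⟩
      · exact Or.inr rfl
  intro v
  by_cases hva : v = a
  · subst hva
    exact key v b d hab (fun h => hda' h.symm) (fun y => by simp only [Sym2.eq_iff]; grind)
      (fun y => by simp only [Sym2.eq_iff]; grind)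
  by_cases hvb : v = b
  · subst hvb
    exact key v a c hab.symm hbc' (fun y => by simp only [Sym2.eq_iff]; grind)
      (fun y => by simp only [Sym2.eq_iff]; grind)
  by_cases hvc : v = c
  · subst hvc
    exact key v d b hcd (fun h => hbc' h.symm) (fun y => by simp only [Sym2.eq_iff]; grind)
      (fun y => by simp only [Sym2.eq_iff]; grind)
  by_cases hvd : v = d
  · subst hvd
    exact key v c a hcd.symm hda' (fun y => by simp only [Sym2.eq_iff]; grind)
      (fun y => by simp only [Sym2.eq_iff]; grind)
  obtain ⟨a', b', hne, hn⟩ := h v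
  refine ⟨a', b', hne, fun y => ?_⟩
  rw [← hn]
  change (H.Adj v y ∧ s(v, y) ≠ s(a, b) ∧ s(v, y) ≠ s(c, d)) ∨
      (s(v, y) = s(b, c) ∨ s(v, y) = s(d, a)) ↔ _
  simp only [ne_eq, Sym2.eq_iff]
  grind

/-- Exchanging the two pairs of opposite edges of an alternating 4-cycle `abcd` between the
members `α` and `β` of an edge partition. -/
theorem EdgePartition.exists_swap {V κ : Type*} {G : SimpleGraph V} {K : κ → SimpleGraph V}
    (hK : EdgePartition G K) (h2 : ∀ i, TwoRegular (K i)) {α β : κ} (hαβ : α ≠ β) {a b c d : V}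
    (hac : a ≠ c) (hbd : b ≠ d) (hab : (K α).Adj a b) (hcd : (K α).Adj c d)
    (hbc : (K β).Adj b c) (hda : (K β).Adj d a) :
    ∃ K' : κ → SimpleGraph V, EdgePartition G K' ∧ (∀ i, TwoRegular (K' i)) ∧
      (∀ i, i ≠ α → i ≠ β → K' i = K i) ∧
      (∀ x y, (K' α).Adj x y ↔ ((K α).Adj x y ∧ s(x, y) ≠ s(a, b) ∧ s(x, y) ≠ s(c, d)) ∨
        s(x, y) = s(b, c) ∨ s(x, y) = s(d, a)) ∧
      (∀ x y, (K' β).Adj x y ↔ ((K β).Adj x y ∧ s(x, y) ≠ s(b, c) ∧ s(x, y) ≠ s(d, a)) ∨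
        s(x, y) = s(c, d) ∨ s(x, y) = s(a, b)) := by
  classical
  have hn : ∀ {x y i j}, i ≠ j → (K i).Adj x y → ¬ (K j).Adj x y := fun hij h h' =>
    hij (hK.eq_of_adj h h')
  let K' : κ → SimpleGraph V := fun i =>
    if i = α then swapEdges (K α) a b c d hbc.ne hda.ne
    else if i = β then swapEdges (K β) b c d a hcd.ne hab.ne else K i
  have hα : K' α = swapEdges (K α) a b c d hbc.ne hda.ne := by simp [K']
  have hβ : K' β = swapEdges (K β) b c d a hcd.ne hab.ne := by simp [K', hαβ.symm]
  have ho : ∀ i, i ≠ α → i ≠ β → K' i = K i := fun i h1 h2 => by simp [K', h1, h2]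
  have hα' : ∀ x y, (K' α).Adj x y ↔ ((K α).Adj x y ∧ s(x, y) ≠ s(a, b) ∧ s(x, y) ≠ s(c, d)) ∨
        s(x, y) = s(b, c) ∨ s(x, y) = s(d, a) := fun x y => by rw [hα]; rfl
  have hβ' : ∀ x y, (K' β).Adj x y ↔ ((K β).Adj x y ∧ s(x, y) ≠ s(b, c) ∧ s(x, y) ≠ s(d, a)) ∨
        s(x, y) = s(c, d) ∨ s(x, y) = s(a, b) := fun x y => by rw [hβ]; rfl
  have tr : ∀ {H : SimpleGraph V} {x y u v : V}, s(x, y) = s(u, v) → (H.Adj x y ↔ H.Adj u v) := by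
    intro H x y u v h
    rw [← mem_edgeSet, h, mem_edgeSet]
  have ne1 : s(a, b) ≠ s(b, c) := by
    intro h; simp only [Sym2.eq_iff] at h; have := hab.ne; grind
  have ne2 : s(a, b) ≠ s(d, a) := by
    intro h; simp only [Sym2.eq_iff] at h; have := hab.ne; grind
  have ne3 : s(c, d) ≠ s(b, c) := by
    intro h; simp only [Sym2.eq_iff] at h; have := hcd.ne; grind
  have ne4 : s(c, d) ≠ s(d, a) := by
    intro h; simp only [Sym2.eq_iff] at h; have := hcd.ne; grind
  refine ⟨K', ⟨?_, ?_⟩, ?_, ho, hα', hβ'⟩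
  · intro i x y hxy
    by_cases hiα : i = α
    · subst hiα
      rcases (hα' x y).mp hxy with h | h | h
      · exact hK.le _ h.1
      · exact (tr h).mpr (hK.le _ hbc)
      · exact (tr h).mpr (hK.le _ hda)
    · by_cases hiβ : i = β
      · subst hiβ
        rcases (hβ' x y).mp hxy with h | h | h
        · exact hK.le _ h.1
        · exact (tr h).mpr (hK.le _ hcd)
        · exact (tr h).mpr (hK.le _ hab)
      · rw [ho i hiα hiβ] at hxy
        exact hK.le _ hxy
  · intro x y hxy
    obtain ⟨i, hi, hu⟩ := hK.existsUnique hxy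
    have hother : ∀ j, j ≠ α → j ≠ β → ((K' j).Adj x y ↔ (K j).Adj x y) := fun j h1 h2 => by
      rw [ho j h1 h2]
    by_cases hE1 : s(x, y) = s(a, b) ∨ s(x, y) = s(c, d)
    · have hxα : (K α).Adj x y := by
        rcases hE1 with h | h
        · exact (tr h).mpr hab
        · exact (tr h).mpr hcd
      have := hu α hxα
      subst this
      refine ⟨β, (hβ' x y).mpr (by tauto), fun j hj => ?_⟩
      by_contra hjβ
      by_cases hjα : j = α
      · subst hjα
        rw [hα'] at hj
        grind
      · replace hj := (hother j hjα hjβ).mp hj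
        exact hjα (hu j hj)
    · by_cases hE2 : s(x, y) = s(b, c) ∨ s(x, y) = s(d, a)
      · have hxβ : (K β).Adj x y := by
          rcases hE2 with h | h
          · exact (tr h).mpr hbc
          · exact (tr h).mpr hda
        have := hu β hxβ
        subst this
        refine ⟨α, (hα' x y).mpr (by tauto), fun j hj => ?_⟩
        by_contra hjα
        by_cases hjβ : j = β
        · subst hjβ
          rw [hβ'] at hj
          grind
        · replace hj := (hother j hjα hjβ).mp hj
          exact hjβ (hu j hj)
      · have hsame : ∀ j, (K' j).Adj x y ↔ (K j).Adj x y := by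
          intro j
          by_cases hjα : j = α
          · subst hjα
            rw [hα']
            tauto
          · by_cases hjβ : j = β
            · subst hjβ
              rw [hβ']
              tauto
            · exact hother j hjα hjβ
        exact ⟨i, (hsame i).mpr hi, fun j hj => hu j ((hsame j).mp hj)⟩
  · intro i
    by_cases hiα : i = α
    · subst hiα
      rw [hα]
      exact swapEdges_twoRegular _ _ hac hbd (h2 _) hab hcd (hn hαβ.symm hbc) (hn hαβ.symm hda)
    · by_cases hiβ : i = β
      · subst hiβ
        rw [hβ]
        exact swapEdges_twoRegular _ _ hbd hac.symm (h2 _) hbc hda (hn hαβ hcd) (hn hαβ hab)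
      · rw [ho i hiα hiβ]
        exact h2 i

/-! ### Connectivity after switching -/

/-- Layer 0 is a cycle without one edge, hence connected. Layer 1 lacks two edges, but the ends of
the first are joined by a detour through layer 0, so effectively one is missing. The same argument
climbs to layer 2, and layer 3 again lacks only one edge. -/
theorem connected_of_layers {V : Type*} {N : ℕ} (hN : 3 ≤ N) {H : SimpleGraph V}
    (hH : IsHamCycle N H) {A : SimpleGraph (V × Fin 4)} {x₀ y₀ x₁ y₁ x₂ y₂ : V}
    (ha₀ : H.Adj x₀ y₀) (ha₁ : H.Adj x₁ y₁) (ha₂ : H.Adj x₂ y₂)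
    (hl₀ : ∀ u v, H.Adj u v → s(u, v) ≠ s(x₀, y₀) → A.Adj (u, 0) (v, 0))
    (hl₁ : ∀ u v, H.Adj u v → s(u, v) ≠ s(x₀, y₀) → s(u, v) ≠ s(x₁, y₁) → A.Adj (u, 1) (v, 1))
    (hl₂ : ∀ u v, H.Adj u v → s(u, v) ≠ s(x₁, y₁) → s(u, v) ≠ s(x₂, y₂) → A.Adj (u, 2) (v, 2))
    (hl₃ : ∀ u v, H.Adj u v → s(u, v) ≠ s(x₂, y₂) → A.Adj (u, 3) (v, 3))
    (hx₀ : A.Adj (x₀, 0) (x₀, 1)) (hy₀ : A.Adj (y₀, 0) (y₀, 1))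
    (hx₁ : A.Adj (x₁, 1) (x₁, 2)) (hy₁ : A.Adj (y₁, 1) (y₁, 2))
    (hx₂ : A.Adj (x₂, 2) (x₂, 3)) : A.Connected := by
  have hR : ∀ l : Fin 4, Equivalence fun u v : V => A.Reachable (u, l) (v, l) := fun l =>
    ⟨fun u => Reachable.refl _, fun h => h.symm, fun h h' => h.trans h'⟩
  have hsw : ∀ {u v p q : V} {l : Fin 4}, s(u, v) = s(p, q) → A.Reachable (p, l) (q, l) →
      A.Reachable (u, l) (v, l) := by
    intro u v p q l h hr
    rcases Sym2.eq_iff.mp h with ⟨rfl, rfl⟩ | ⟨rfl, rfl⟩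
    · exact hr
    · exact hr.symm
  have c₀ : ∀ u v, A.Reachable (u, 0) (v, 0) :=
    hH.rel_of_forall_ne hN (hR 0) ha₀ fun u v h hne => (hl₀ u v h hne).reachable
  have c₁ : ∀ u v, A.Reachable (u, 1) (v, 1) :=
    hH.rel_of_forall_ne hN (hR 1) ha₁ fun u v h hne => by
      by_cases he : s(u, v) = s(x₀, y₀)
      · exact hsw he ((hx₀.symm.reachable.trans (c₀ x₀ y₀)).trans hy₀.reachable)
      · exact (hl₁ u v h he hne).reachable
  have c₂ : ∀ u v, A.Reachable (u, 2) (v, 2) :=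
    hH.rel_of_forall_ne hN (hR 2) ha₂ fun u v h hne => by
      by_cases he : s(u, v) = s(x₁, y₁)
      · exact hsw he ((hx₁.symm.reachable.trans (c₁ x₁ y₁)).trans hy₁.reachable)
      · exact (hl₂ u v h he hne).reachable
  have c₃ : ∀ u v, A.Reachable (u, 3) (v, 3) :=
    hH.rel_of_forall_ne hN (hR 3) ha₂ fun u v h hne => (hl₃ u v h hne).reachable
  have hall : ∀ l u, A.Reachable (x₀, 0) (u, l) := by
    have r₁ : ∀ u, A.Reachable (x₀, 0) (u, 1) := fun u => hx₀.reachable.trans (c₁ _ _)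
    have r₂ : ∀ u, A.Reachable (x₀, 0) (u, 2) := fun u =>
      ((r₁ x₁).trans hx₁.reachable).trans (c₂ _ _)
    have r₃ : ∀ u, A.Reachable (x₀, 0) (u, 3) := fun u =>
      ((r₂ x₂).trans hx₂.reachable).trans (c₃ _ _)
    intro l u
    fin_cases l
    · exact c₀ _ _
    · exact r₁ u
    · exact r₂ u
    · exact r₃ u
  have : Nonempty (V × Fin 4) := ⟨(x₀, 0)⟩
  exact ⟨fun p q => (hall p.2 p.1).symm.trans (hall q.2 q.1)⟩

/-- `par` is a tree rooted at `r`; the switch on the tree edge from `v` to `par v` opens both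
columns at level `lev v` and joins them by two rungs. Merging cycles along a tree leaves one cycle.
-/
theorem connected_of_columns {V : Type*} {N : ℕ} {A : SimpleGraph (V × Fin 4)} (pos : V → ℕ)
    (hpos : ∀ v, pos v < N) (r : V) (par : V → V) (lev : V → Fin 4)
    (hpar : ∀ v, v ≠ r → pos (par v) < pos v)
    (hor : ∀ v, v ≠ r → A.Adj (v, lev v) (par v, lev v))
    (hor' : ∀ v, v ≠ r → A.Adj (v, lev v + 1) (par v, lev v + 1))
    (hvert : ∀ v l, A.Adj (v, l) (v, l + 1) ∨ (v ≠ r ∧ l = lev v) ∨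
      ∃ c, c ≠ r ∧ par c = v ∧ lev c = l) : A.Connected := by
  -- From the leaves upwards: the gap in the column of `v` belonging to its parent edge is bypassed
  -- by going round the other three levels, any gap there being bridged through the corresponding
  -- child.
  have own : ∀ n v, v ≠ r → N - pos v ≤ n → A.Reachable (v, lev v) (v, lev v + 1) := by
    intro n
    induction n with
    | zero => intro v _ h; have := hpos v; omega
    | succ n ih =>
      intro v hv hn
      have hother : ∀ l, l ≠ lev v → A.Reachable (v, l) (v, l + 1) := by
        intro l hl
        rcases hvert v l with h | ⟨_, h⟩ | ⟨c, hc, rfl, rfl⟩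
        · exact h.reachable
        · exact (hl h).elim
        · have h1 := hpar c hc
          have h2 := hpos c
          exact ((hor c hc).symm.reachable.trans (ih c hc (by omega))).trans (hor' c hc).reachable
      have e : ∀ l : Fin 4, l + 1 ≠ l ∧ l + 1 + 1 ≠ l ∧ l + 1 + 1 + 1 ≠ l ∧
          l + 1 + 1 + 1 + 1 = l := by decide
      obtain ⟨e1, e2, e3, e4⟩ := e (lev v)
      have h := ((hother _ e1).trans (hother _ e2)).trans (hother _ e3)
      rw [e4] at h
      exact h.symm
  have hstep : ∀ v l, A.Reachable (v, l) (v, l + 1) := by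
    intro v l
    rcases hvert v l with h | ⟨hv, h⟩ | ⟨c, hc, rfl, rfl⟩
    · exact h.reachable
    · rw [h]
      exact own _ v hv le_rfl
    · exact ((hor c hc).symm.reachable.trans (own _ c hc le_rfl)).trans (hor' c hc).reachable
  have hcol : ∀ v l, A.Reachable (v, 0) (v, l) := by
    intro v l
    have h1 := hstep v 0
    have h2 := h1.trans (hstep v 1)
    have h3 := h2.trans (hstep v 2)
    fin_cases l
    · exact Reachable.refl _
    · exact h1
    · exact h2
    · exact h3
  have hroot : ∀ n v, pos v ≤ n → A.Reachable (r, 0) (v, 0) := by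
    intro n
    induction n with
    | zero =>
      intro v hn
      by_cases hv : v = r
      · rw [hv]
      · have := hpar v hv
        omega
    | succ n ih =>
      intro v hn
      by_cases hv : v = r
      · rw [hv]
      · have := hpar v hv
        exact (((ih _ (by omega)).trans (hcol _ _)).trans (hor v hv).symm.reachable).trans
          (hcol _ _).symm
  have hall : ∀ p : V × Fin 4, A.Reachable (r, 0) p := fun p =>
    (hroot _ p.1 le_rfl).trans (hcol _ _)
  have : Nonempty (V × Fin 4) := ⟨(r, 0)⟩
  exact ⟨fun p q => (hall p).symm.trans (hall q)⟩

/-- Here `A` is the switched and exchanged cycle `K c₀`. The exchange deletes the level 0 vertical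
edges at `w 0` and `w (N - 3)`, which explains the exclusions in `vert'`, and supplies `hg₀` and
`hg₁`. The columns from `w 2` to `w (N - 4)` are connected inductively by the zigzag; the few
remaining ones are joined by the prescribed values of `t` at both ends. -/
theorem connected_of_zigzag {V : Type*} {N : ℕ} (hN : 8 ≤ N) {A : SimpleGraph (V × Fin 4)}
    (w : ℕ → V) (hw : ∀ x, ∃ k, k < N ∧ w k = x) (t : ℕ → Fin 4) (used : ℕ → Prop)
    (hor : ∀ k l, k < N - 1 → (used k → l ≠ t k ∧ l ≠ t k + 1) → A.Adj (w k, l) (w (k + 1), l))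
    (hwrap : ∀ l, A.Adj (w (N - 1), l) (w 0, l))
    (vert : ∀ k, k < N - 1 → used k → A.Adj (w (k + 1), t k) (w (k + 1), t k + 1))
    (vert' : ∀ k, k < N - 1 → used k → k ≠ 0 → k ≠ N - 3 → A.Adj (w k, t k) (w k, t k + 1))
    (hg₀ : A.Adj (w (N - 3), 0) (w 0, 0)) (hg₁ : A.Adj (w (N - 3), 1) (w 0, 1))
    (u₀ : used 0) (u₁ : used 1) (u₄ : used (N - 4)) (u₃ : used (N - 3)) (u₂ : used (N - 2))
    (t₀ : t 0 = 0) (t₁ : t 1 = 2) (t₄ : t (N - 4) = 3) (t₃ : t (N - 3) = 0) (t₂ : t (N - 2) = 3)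
    (step : ∀ k, 1 ≤ k → k + 1 ≤ N - 4 → used k → used (k + 1) →
      t (k + 1) = t k + 1 ∨ t k = t (k + 1) + 1)
    (step' : ∀ k, 1 ≤ k → k + 2 ≤ N - 4 → used k → ¬ used (k + 1) → used (k + 2) →
      t (k + 2) = t k + 1 ∨ t k = t (k + 2) + 1)
    (hiso : ∀ k, used k ∨ used (k + 1)) : A.Connected := by
  -- At `w k` only the two layers that remain open for the step to `w (k + 1)` are claimed: at `k =
  -- 1` the other two are not yet reached.
  have key : ∀ n k, k ≤ n → 1 ≤ k → k ≤ N - 4 → used k →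
      (∀ l, l ≠ t k → l ≠ t k + 1 → A.Reachable (w 1, 0) (w k, l)) ∧
      ∀ k', 2 ≤ k' → k' ≤ k → ∀ l, A.Reachable (w 1, 0) (w k', l) := by
    have f1 : ∀ l : Fin 4, l + 1 + 1 ≠ l ∧ l + 1 + 1 ≠ l + 1 ∧ l + 1 + 1 + 1 ≠ l ∧
        l + 1 + 1 + 1 ≠ l + 1 ∧ l + 1 + 1 + 1 + 1 = l := by decide
    have f2 : ∀ m l : Fin 4, l = m ∨ l = m + 1 ∨ l = m + 1 + 1 ∨ l = m + 1 + 1 + 1 := by decide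
    intro n
    induction n with
    | zero => intro k hk hk1; omega
    | succ n ih =>
      intro k hk hk1 hkN uk
      rcases hk1.eq_or_lt with rfl | hk2
      · refine ⟨fun l hl hl' => ?_, fun k' h1 h2 => by omega⟩
        rw [t₁] at hl hl'
        have hv := vert 0 (by omega) u₀
        rw [t₀] at hv
        fin_cases l
        · exact Reachable.refl _
        · exact hv.reachable
        · exact (hl rfl).elim
        · exact (hl' rfl).elim
      · suffices hmain : ∀ k', 2 ≤ k' → k' ≤ k → ∀ l, A.Reachable (w 1, 0) (w k', l) from
          ⟨fun l _ _ => hmain k hk2 le_rfl l, hmain⟩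
        obtain ⟨j, rfl⟩ : ∃ j, k = j + 1 := ⟨k - 1, by omega⟩
        by_cases uj : used j
        · obtain ⟨h1, h2⟩ := ih j (by omega) (by omega) (by omega) uj
          obtain ⟨g1, g2, g3, g4, g5⟩ := f1 (t j)
          have a2 : A.Reachable (w 1, 0) (w (j + 1), t j + 1 + 1) :=
            (h1 _ g1 g2).trans (hor j _ (by omega) fun _ => ⟨g1, g2⟩).reachable
          have a3 : A.Reachable (w 1, 0) (w (j + 1), t j + 1 + 1 + 1) :=
            (h1 _ g3 g4).trans (hor j _ (by omega) fun _ => ⟨g3, g4⟩).reachable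
          have v1 := vert j (by omega) uj
          have v2 := vert' (j + 1) (by omega) uk (by omega) (by omega)
          -- Two layers carry over from `w j`. The other two are joined to each other by the
          -- vertical edge of level `t j`, and the one of level `t (j + 1)`, a neighbouring level,
          -- joins them to the first two.
          have hcol : ∀ l, A.Reachable (w 1, 0) (w (j + 1), l) := by
            rcases step j (by omega) (by omega) uj uk with h | h
            · rw [h] at v2
              have a1 := a2.trans v2.symm.reachable
              have a0 := a1.trans v1.symm.reachable
              intro l
              rcases f2 (t j) l with rfl | rfl | rfl | rfl <;> assumption
            · have h' : t (j + 1) = t j + 1 + 1 + 1 := by rw [h, (f1 _).2.2.2.2]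
              rw [h', g5] at v2
              have a0 := a3.trans v2.reachable
              have a1 := a0.trans v1.reachable
              intro l
              rcases f2 (t j) l with rfl | rfl | rfl | rfl <;> assumption
          intro k' hk' hk'' l
          rcases hk''.eq_or_lt with rfl | hlt
          · exact hcol l
          · exact h2 k' hk' (by omega) l
        · obtain ⟨i, rfl⟩ : ∃ i, j = i + 1 := by
            refine ⟨j - 1, ?_⟩
            omega
          have hi : 1 ≤ i := by
            by_contra hi
            obtain rfl : i = 0 := by omega
            exact uj u₁
          have ui : used i := (hiso i).resolve_right uj
          obtain ⟨h1, h2⟩ := ih i (by omega) (by omega) (by omega) ui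
          obtain ⟨g1, g2, g3, g4, g5⟩ := f1 (t i)
          have a2 : A.Reachable (w 1, 0) (w (i + 1), t i + 1 + 1) :=
            (h1 _ g1 g2).trans (hor i _ (by omega) fun _ => ⟨g1, g2⟩).reachable
          have a3 : A.Reachable (w 1, 0) (w (i + 1), t i + 1 + 1 + 1) :=
            (h1 _ g3 g4).trans (hor i _ (by omega) fun _ => ⟨g3, g4⟩).reachable
          -- No edge is switched away on the unused step, so the columns at both its ends act as
          -- one.
          have hh : ∀ l, A.Reachable (w (i + 1), l) (w (i + 1 + 1), l) := fun l =>
            (hor (i + 1) l (by omega) fun h => (uj h).elim).reachable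
          have v1 := vert i (by omega) ui
          have v2 := vert' (i + 1 + 1) (by omega) uk (by omega) (by omega)
          have hcol : ∀ l, A.Reachable (w 1, 0) (w (i + 1), l) := by
            rcases step' i (by omega) (by omega) ui uj uk with h | h
            · rw [show i + 2 = i + 1 + 1 from rfl] at h
              rw [h] at v2
              have a1 := ((a2.trans (hh _)).trans v2.symm.reachable).trans (hh _).symm
              have a0 := a1.trans v1.symm.reachable
              intro l
              rcases f2 (t i) l with rfl | rfl | rfl | rfl <;> assumption
            · rw [show i + 2 = i + 1 + 1 from rfl] at h
              have h' : t (i + 1 + 1) = t i + 1 + 1 + 1 := by rw [h, (f1 _).2.2.2.2]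
              rw [h', g5] at v2
              have a0 := ((a3.trans (hh _)).trans v2.reachable).trans (hh _).symm
              have a1 := a0.trans v1.reachable
              intro l
              rcases f2 (t i) l with rfl | rfl | rfl | rfl <;> assumption
          intro k' hk' hk'' l
          rcases hk''.eq_or_lt with rfl | hlt
          · exact (hcol l).trans (hh l)
          · rcases (Nat.lt_succ_iff.mp hlt).eq_or_lt with rfl | hlt'
            · exact hcol l
            · exact h2 k' hk' (by omega) l
  obtain ⟨M, rfl⟩ : ∃ M, N = M + 4 := ⟨N - 4, by omega⟩
  simp only [show M + 4 - 1 = M + 3 by omega, show M + 4 - 2 = M + 2 by omega,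
    show M + 4 - 3 = M + 1 by omega, show M + 4 - 4 = M by omega] at *
  obtain ⟨-, hM⟩ := key M M le_rfl (by omega) le_rfl u₄
  -- The rest is one explicit walk: out in layer 2 across the closing edge to `w 1`, up to layer 3
  -- and back to `w (M + 3)`, to layer 0, over the exchanged edge `hg₀` to `w (M + 1)`, and finally
  -- out again in layer 1.
  have a1 : A.Reachable (w 1, 0) (w (M + 1), 1) := (hM M (by omega) le_rfl 1).trans
    (hor M 1 (by omega) fun _ => by rw [t₄]; decide).reachable
  have a2 : A.Reachable (w 1, 0) (w (M + 1), 2) := (hM M (by omega) le_rfl 2).trans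
    (hor M 2 (by omega) fun _ => by rw [t₄]; decide).reachable
  have b2 : A.Reachable (w 1, 0) (w (M + 2), 2) := a2.trans
    (hor (M + 1) 2 (by omega) fun _ => by rw [t₃]; decide).reachable
  have c2 : A.Reachable (w 1, 0) (w (M + 3), 2) := b2.trans
    (hor (M + 2) 2 (by omega) fun _ => by rw [t₂]; decide).reachable
  have d2 : A.Reachable (w 1, 0) (w 0, 2) := c2.trans (hwrap 2).reachable
  have e2 : A.Reachable (w 1, 0) (w 1, 2) := d2.trans
    (hor 0 2 (by omega) fun _ => by rw [t₀]; decide).reachable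
  have v1 := vert' 1 (by omega) u₁ (by omega) (by omega)
  rw [t₁] at v1
  have e3 : A.Reachable (w 1, 0) (w 1, 3) := e2.trans v1.reachable
  have d3 : A.Reachable (w 1, 0) (w 0, 3) := e3.trans
    (hor 0 3 (by omega) fun _ => by rw [t₀]; decide).symm.reachable
  have c3 : A.Reachable (w 1, 0) (w (M + 3), 3) := d3.trans (hwrap 3).symm.reachable
  have v3 := vert (M + 2) (by omega) u₂
  rw [t₂] at v3
  have c0 : A.Reachable (w 1, 0) (w (M + 3), 0) := c3.trans v3.reachable
  have d0 : A.Reachable (w 1, 0) (w 0, 0) := c0.trans (hwrap 0).reachable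
  have a0 : A.Reachable (w 1, 0) (w (M + 1), 0) := d0.trans hg₀.symm.reachable
  have v4 := vert M (by omega) u₄
  rw [t₄] at v4
  have a3 : A.Reachable (w 1, 0) (w (M + 1), 3) := a0.trans v4.symm.reachable
  have b3 : A.Reachable (w 1, 0) (w (M + 2), 3) := a3.trans
    (hor (M + 1) 3 (by omega) fun _ => by rw [t₃]; decide).reachable
  have v5 := vert' (M + 2) (by omega) u₂ (by omega) (by omega)
  rw [t₂] at v5
  have b0 : A.Reachable (w 1, 0) (w (M + 2), 0) := b3.trans v5.reachable
  have v6 := vert (M + 1) (by omega) u₃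
  rw [t₃] at v6
  have b1 : A.Reachable (w 1, 0) (w (M + 2), 1) := b0.trans v6.reachable
  have c1 : A.Reachable (w 1, 0) (w (M + 3), 1) := b1.trans
    (hor (M + 2) 1 (by omega) fun _ => by rw [t₂]; decide).reachable
  have d1 : A.Reachable (w 1, 0) (w 0, 1) := c1.trans (hwrap 1).reachable
  have v0 := vert 0 (by omega) u₀
  rw [t₀] at v0
  have e1 : A.Reachable (w 1, 0) (w 1, 1) := v0.reachable
  have hall : ∀ p, A.Reachable (w 1, 0) p := by
    rintro ⟨x, l⟩
    obtain ⟨k, hk, rfl⟩ := hw x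
    by_cases hkM : 2 ≤ k ∧ k ≤ M
    · exact hM k hkM.1 hkM.2 l
    · obtain rfl | rfl | rfl | rfl | rfl : k = 0 ∨ k = 1 ∨ k = M + 1 ∨ k = M + 2 ∨ k = M + 3 := by
        omega
      all_goals fin_cases l <;> first | assumption | exact Reachable.refl _
  have : Nonempty (V × Fin 4) := ⟨(w 1, 0)⟩
  exact ⟨fun p q => (hall p).symm.trans (hall q)⟩

/-! ### Choosing the levels and the side edges -/

/-- Two positions are equal or consecutive. -/
def Near (u v : ℕ) : Prop := u = v ∨ v = u + 1 ∨ u = v + 1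

/-- Side switches have levels 0, 1 or 2, so level 3 never collides with one. Alternating 3 with a
choice of 0 or 2, both adjacent to 3 modulo 4, leaves room to dodge the level of a nearby side
switch; the ends of side edges are far apart, so there is at most one to dodge. -/
theorem exists_levels {ι : Type*} {N : ℕ} (hNe : Even N) (hN : 10 ≤ N) (J : Finset ι)
    (hJ : Even J.card) (a b : ι → ℕ) (s : ι → Fin 3) (hab : ∀ q ∈ J, a q < b q)
    (ha : ∀ q ∈ J, 4 ≤ a q) (hb : ∀ q ∈ J, b q + 5 ≤ N)
    (hfar : ∀ q ∈ J, ∀ q' ∈ J, ∀ u u', u = a q ∨ u = b q → u' = a q' ∨ u' = b q' → Near u u' →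
      q = q' ∧ u = u') :
    ∃ (t : ℕ → Fin 4) (used : ℕ → Prop), (∀ k, used k ↔ ∀ q ∈ J, b q ≠ k + 1) ∧
      (∀ k, used k ∨ used (k + 1)) ∧
      t 0 = 0 ∧ t 1 = 2 ∧ t (N - 4) = 3 ∧ t (N - 3) = 0 ∧ t (N - 2) = 3 ∧
      (∀ k, 1 ≤ k → k + 1 ≤ N - 2 → used k → used (k + 1) →
        t (k + 1) = t k + 1 ∨ t k = t (k + 1) + 1) ∧
      (∀ k, 1 ≤ k → k + 2 ≤ N - 2 → used k → ¬ used (k + 1) → used (k + 2) →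
        t (k + 2) = t k + 1 ∨ t k = t (k + 2) + 1) ∧
      (∀ q ∈ J, ∀ k, used k → ∀ u, u = a q ∨ u = b q → k = u ∨ k + 1 = u →
        t k ≠ (s q).castSucc) := by
  classical
  -- `ns k` counts the unused steps below `k`. Adding it to `k` makes the parity alternate along the
  -- used steps only. The evenness of `N` and of `J.card` then makes `N - 4` and `N - 2` even
  -- places, with level 3, and `N - 3` an odd one.
  let ns : ℕ → ℕ := fun k => (J.filter fun q => b q ≤ k).card
  let near2 : ℕ → Prop := fun k => ∃ q ∈ J, s q = 2 ∧ ∃ u, (u = a q ∨ u = b q) ∧ (k = u ∨ k + 1 = u)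
  let t : ℕ → Fin 4 := fun k =>
    if k = 0 ∨ k = N - 3 then 0 else if Even (k + ns k) then 3 else if near2 k then 0 else 2
  let used : ℕ → Prop := fun k => ∀ q ∈ J, b q ≠ k + 1
  have ns_small : ∀ k, k < 5 → ns k = 0 := by
    intro k hk
    refine Finset.card_eq_zero.mpr (Finset.filter_eq_empty_iff.mpr fun q hq => ?_)
    have := ha q hq
    have := hab q hq
    omega
  have ns_large : ∀ k, N - 5 ≤ k → ns k = J.card := by
    intro k hk
    refine congrArg Finset.card (Finset.filter_true_of_mem fun q hq => ?_)
    have := hb q hq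
    omega
  have ns_succ : ∀ k, used k → ns (k + 1) = ns k := by
    intro k hk
    refine congrArg Finset.card (Finset.filter_congr fun q hq => ?_)
    have := hk q hq
    omega
  have ns_skip : ∀ k, ¬ used k → ns (k + 1) = ns k + 1 := by
    intro k hk
    simp only [used, not_forall, not_not] at hk
    obtain ⟨q, hq, hqk⟩ := hk
    have : J.filter (fun q => b q ≤ k + 1) = insert q (J.filter fun q => b q ≤ k) := by
      ext q'
      simp only [Finset.mem_filter, Finset.mem_insert]
      constructor
      · rintro ⟨h1, h2⟩
        rcases h2.eq_or_lt with h3 | h3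
        · left
          exact (hfar q' h1 q hq (b q') (b q) (Or.inr rfl) (Or.inr rfl)
            (Or.inl (by omega))).1
        · exact Or.inr ⟨h1, by omega⟩
      · rintro (rfl | ⟨h1, h2⟩)
        · exact ⟨hq, by omega⟩
        · exact ⟨h1, by omega⟩
    simp only [ns]
    rw [this, Finset.card_insert_of_notMem]
    simp only [Finset.mem_filter, not_and]
    omega
  have t_odd : ∀ k, 1 ≤ k → ¬ Even (k + ns k) → t k = 0 ∨ t k = 2 := by
    intro k hk h
    simp only [t]
    split_ifs <;> simp
  have t_even : ∀ k, 1 ≤ k → Even (k + ns k) → t k = 3 := by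
    intro k hk h
    simp only [t]
    rw [if_neg, if_pos h]
    rintro (h0 | rfl)
    · omega
    · rw [ns_large _ (by omega)] at h
      rw [Nat.even_iff] at *
      omega
  have hsteps : ∀ k k', 1 ≤ k → 1 ≤ k' → (Even (k + ns k) ↔ ¬ Even (k' + ns k')) →
      t k' = t k + 1 ∨ t k = t k' + 1 := by
    intro k k' hk hk' hiff
    by_cases h : Even (k + ns k)
    · rw [t_even k hk h]
      rcases t_odd k' hk' (hiff.mp h) with h' | h' <;> rw [h'] <;> decide
    · rw [t_even k' hk' (by tauto)]
      rcases t_odd k hk h with h' | h' <;> rw [h'] <;> decide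
  refine ⟨t, used, fun k => Iff.rfl, ?_, by simp [t], ?_, ?_, by simp [t], ?_, ?_, ?_, ?_⟩
  · intro k
    by_contra h
    simp only [used, not_or, not_forall, not_not] at h
    obtain ⟨⟨q, hq, h1⟩, q', hq', h2⟩ := h
    have := (hfar q hq q' hq' (b q) (b q') (Or.inr rfl) (Or.inr rfl)
      (Or.inr (Or.inl (by omega)))).2
    omega
  · simp only [t, ns_small 1 (by norm_num)]
    rw [if_neg (by omega), if_neg (by decide), if_neg]
    rintro ⟨q, hq, _, u, hu, hk⟩
    have := ha q hq
    have := hab q hq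
    omega
  · apply t_even _ (by omega)
    rw [ns_large _ (by omega)]
    rw [Nat.even_iff] at *
    omega
  · apply t_even _ (by omega)
    rw [ns_large _ (by omega)]
    rw [Nat.even_iff] at *
    omega
  · intro k hk _ u1 u2
    refine hsteps k (k + 1) hk (by omega) ?_
    rw [ns_succ k u1, Nat.even_iff, Nat.even_iff]
    omega
  · intro k hk _ u1 u2 u3
    refine hsteps k (k + 2) hk (by omega) ?_
    rw [ns_skip (k + 1) u2, ns_succ k u1, Nat.even_iff, Nat.even_iff]
    omega
  · intro q hq k uk u hu hku
    have h1 := ha q hq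
    have h2 := hab q hq
    have h3 := hb q hq
    have hs : ∀ s : Fin 3, s.castSucc ≠ 3 ∧ (s.castSucc = 2 ↔ s = 2) ∧
      (s.castSucc = 0 ↔ s = 0) := by decide
    obtain ⟨s1, s2, s3⟩ := hs (s q)
    simp only [t]
    rw [if_neg (by omega)]
    split_ifs with h4 h5
    · exact s1.symm
    · intro h6
      obtain ⟨q', hq', hs', u', hu', hku'⟩ := h5
      have := (hfar q hq q' hq' u u' hu hu' (by unfold Near; omega)).1
      subst this
      rw [s3.mp h6.symm] at hs'
      exact absurd hs' (by decide)
    · intro h6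
      exact h5 ⟨q, hq, s2.mp h6.symm, u, hu, hku⟩

/-- Greedy choice. Each earlier edge forbids at most six vertices, and a forbidden vertex excludes
as starting point only itself and its two neighbours in `K (c q)`; this is the factor 3. -/
theorem exists_far_edges {V κ ι : Type*} [Fintype V] [Nonempty V] [DecidableEq V] [DecidableEq ι]
    (K : κ → SimpleGraph V) (hK : ∀ i, TwoRegular (K i)) (c : ι → κ) (D : V → Finset V)
    (hD : ∀ v, (D v).card ≤ 3) (hDs : ∀ u v, u ∈ D v → v ∈ D u) (bad : Finset V) (J : Finset ι)
    (hcard : 3 * (bad.card + 6 * J.card) ≤ Fintype.card V) :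
    ∃ f : ι → V × V, (∀ q ∈ J, (K (c q)).Adj (f q).1 (f q).2 ∧ (f q).1 ∉ bad ∧ (f q).2 ∉ bad) ∧
      ∀ q ∈ J, ∀ q' ∈ J, q ≠ q' → ∀ u u', u = (f q).1 ∨ u = (f q).2 →
        u' = (f q').1 ∨ u' = (f q').2 → u ∉ D u' := by
  induction J using Finset.induction_on with
  | empty =>
    inhabit V
    exact ⟨fun _ => (default, default), by simp, by simp⟩
  | insert q J hq ih =>
    rw [Finset.card_insert_of_notMem hq] at hcard
    obtain ⟨f, hf, hfar⟩ := ih (by omega)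
    choose n₁ n₂ _ hn using fun v => hK (c q) v
    let B : Finset V := bad ∪ J.biUnion fun q' => D (f q').1 ∪ D (f q').2
    let B' : Finset V := B ∪ (B.image n₁ ∪ B.image n₂)
    have hB : B.card ≤ bad.card + J.card * 6 := by
      refine (Finset.card_union_le _ _).trans (Nat.add_le_add_left ?_ _)
      refine Finset.card_biUnion_le_card_mul _ _ _ fun q' _ => ?_
      refine (Finset.card_union_le _ _).trans ?_
      have := hD (f q').1
      have := hD (f q').2
      omega
    have hB' : B'.card ≤ 3 * B.card := by
      refine (Finset.card_union_le _ _).trans ?_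
      have h1 := Finset.card_union_le (B.image n₁) (B.image n₂)
      have h2 := Finset.card_image_le (s := B) (f := n₁)
      have h3 := Finset.card_image_le (s := B) (f := n₂)
      omega
    obtain ⟨x, hx⟩ : ∃ x, x ∉ B' := by
      by_contra hall
      push Not at hall
      have := Finset.card_le_card (fun x _ => hall x : Finset.univ ⊆ B')
      rw [Finset.card_univ] at this
      omega
    have hxB : x ∉ B := fun h => hx (Finset.mem_union_left _ h)
    have hadj : (K (c q)).Adj x (n₁ x) := (hn x _).mpr (Or.inl rfl)
    have hyB : n₁ x ∉ B := by
      intro h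
      apply hx
      refine Finset.mem_union_right _ ?_
      rcases (hn _ _).mp hadj.symm with h' | h'
      · exact Finset.mem_union_left _ (Finset.mem_image.mpr ⟨_, h, h'.symm⟩)
      · exact Finset.mem_union_right _ (Finset.mem_image.mpr ⟨_, h, h'.symm⟩)
    have hbad : ∀ u, u = x ∨ u = n₁ x → u ∉ bad ∧ ∀ q' ∈ J, ∀ u', u' = (f q').1 ∨ u' = (f q').2 →
        u ∉ D u' := by
      intro u hu
      have huB : u ∉ B := by rcases hu with rfl | rfl <;> assumption
      refine ⟨fun h => huB (Finset.mem_union_left _ h), fun q' hq' u' hu' h => huB ?_⟩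
      refine Finset.mem_union_right _ (Finset.mem_biUnion.mpr ⟨q', hq', ?_⟩)
      rcases hu' with rfl | rfl
      · exact Finset.mem_union_left _ h
      · exact Finset.mem_union_right _ h
    have hne : ∀ q' ∈ J, q' ≠ q := fun q' hq' h => hq (h ▸ hq')
    refine ⟨Function.update f q (x, n₁ x), ?_, ?_⟩
    · intro q' hq'
      rcases Finset.mem_insert.mp hq' with rfl | hq'
      · rw [Function.update_self]
        exact ⟨hadj, (hbad _ (Or.inl rfl)).1, (hbad _ (Or.inr rfl)).1⟩
      · rw [Function.update_of_ne (hne q' hq')]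
        exact hf q' hq'
    · intro q₁ hq₁ q₂ hq₂ hne' u u' hu hu'
      rcases Finset.mem_insert.mp hq₁ with rfl | hq₁'
      · rcases Finset.mem_insert.mp hq₂ with rfl | hq₂
        · exact (hne' rfl).elim
        · rw [Function.update_self] at hu
          rw [Function.update_of_ne (hne q₂ hq₂)] at hu'
          exact (hbad u hu).2 q₂ hq₂ u' hu'
      · rw [Function.update_of_ne (hne q₁ hq₁')] at hu
        rcases Finset.mem_insert.mp hq₂ with rfl | hq₂
        · rw [Function.update_self] at hu'
          exact fun h => (hbad u' hu').2 q₁ hq₁' u hu (hDs _ _ h)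
        · rw [Function.update_of_ne (hne q₂ hq₂)] at hu'
          exact hfar q₁ hq₁' q₂ hq₂ hne' u u' hu hu'

/-! ### The product with a 4-cycle -/

theorem HookDecomposable.boxProd_fourCycle {V κ : Type*} [Fintype κ] {N : ℕ} {G : SimpleGraph V}
    (hκ : Even (Fintype.card κ)) (hκ3 : 3 ≤ Fintype.card κ) (hNe : Even N)
    (hN : 54 * Fintype.card κ ≤ N) (h : HookDecomposable κ N G) :
    HookDecomposable (Option κ) (N * 4) (G □ fourCycle) := by
  classical
  obtain ⟨K, hK, hc, c₀, c₁, p₀, p₁, p₂, p₃, hc01, h02, h13, h01, h12, h23, h03⟩ := h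
  have hN3 : 3 ≤ N := by omega
  have h2 : ∀ i, TwoRegular (K i) := fun i => (hc i).twoRegular hN3
  have : NeZero N := ⟨by omega⟩
  let _ : Fintype V := Fintype.ofEquiv (ZMod N) (hc c₀).choose.symm
  have hcard : Fintype.card V = N := by
    rw [Fintype.card_congr (hc c₀).choose, ZMod.card]
  have : Nonempty V := ⟨p₀⟩
  -- Enumerating from the hook edge `p₂p₃` places `p₃` at position 0 and `p₂`, `p₁`, `p₀` at `N -
  -- 1`, `N - 2`, `N - 3`.
  obtain ⟨w, pos, hposlt, hwpos, hposw, hadjw, hw0, hwN1, hwN⟩ :=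
    (hc c₀).exists_enumeration hN3 h23
  have hwinj : ∀ {k k'}, k < N → k' < N → w k = w k' → k = k' := fun hk hk' h => by
    rw [← hposw _ hk, h, hposw _ hk']
  have hposinj : ∀ {x y}, pos x = pos y → x = y := fun {x y} h => by rw [← hwpos x, h, hwpos]
  have hwN2 : p₁ = w (N - 2) := by
    have e1 : (K c₀).Adj p₂ (w (N - 2)) := by
      have := hadjw (N - 2)
      rw [show N - 2 + 1 = N - 1 by omega, hwN1] at this
      exact this.symm
    have hne : w (N - 2) ≠ p₃ := fun h => by
      have := hwinj (by omega) (by omega) (h.trans hw0.symm)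
      omega
    exact (((h2 c₀).adj_iff_of_adj hne e1 h23 p₁).mp h12.symm).resolve_right h13
  have hwN3 : p₀ = w (N - 3) := by
    have e1 : (K c₀).Adj p₁ (w (N - 3)) := by
      have := hadjw (N - 3)
      rw [show N - 3 + 1 = N - 2 by omega, ← hwN2] at this
      exact this.symm
    have hne : w (N - 3) ≠ p₂ := fun h => by
      have := hwinj (by omega) (by omega) (h.trans hwN1.symm)
      omega
    exact (((h2 c₀).adj_iff_of_adj hne e1 h12 p₀).mp h01.symm).resolve_right h02
  -- the switched edges of the cycles other than `K c₀`
  let J : Finset (κ × Fin 3) := ((Finset.univ.erase c₀) ×ˢ Finset.univ).erase (c₁, 0)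
  have hJmem : ∀ i s, (i, s) ∈ J ↔ i ≠ c₀ ∧ ¬ (i = c₁ ∧ s = 0) := by
    intro i s
    simp only [J, Finset.mem_erase, Finset.mem_product, Finset.mem_univ, and_true, ne_eq,
      Prod.mk.injEq]
    tauto
  -- Without `(c₁, 0)`, whose role the hook takes over, this number is even because `Fintype.card κ`
  -- is.
  have hJcard : J.card = (Fintype.card κ - 1) * 3 - 1 := by
    simp only [J]
    rw [Finset.card_erase_of_mem, Finset.card_product, Finset.card_erase_of_mem (Finset.mem_univ _),
      Finset.card_univ, Finset.card_univ, Fintype.card_fin]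
    simp [hc01.symm]
  let D : V → Finset V := fun v => Finset.univ.filter fun u => Near (pos u) (pos v)
  have hDmem : ∀ u v, u ∈ D v ↔ Near (pos u) (pos v) := fun u v => by simp [D]
  have hD : ∀ v, (D v).card ≤ 3 := by
    intro v
    refine (Finset.card_le_card (t := {w (pos v), w (pos v - 1), w (pos v + 1)}) ?_).trans
      Finset.card_le_three
    intro u hu
    rw [hDmem, Near] at hu
    simp only [Finset.mem_insert, Finset.mem_singleton]
    rcases hu with hu | hu | hu
    · left; rw [← hu, hwpos]
    · right; left; rw [hu, Nat.add_sub_cancel, hwpos]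
    · right; right; rw [← hu, hwpos]
  have hDs : ∀ u v, u ∈ D v → v ∈ D u := by
    intro u v hu
    rw [hDmem, Near] at hu ⊢
    omega
  -- Both ends of the path are kept free of side edges, since the levels there are prescribed.
  let bad : Finset V :=
    (Finset.range 4).image w ∪ (Finset.range 4).image fun k => w (N - 4 + k)
  have hbadcard : bad.card ≤ 8 := by
    refine (Finset.card_union_le _ _).trans ?_
    have a1 := Finset.card_image_le (s := Finset.range 4) (f := w)
    have a2 := Finset.card_image_le (s := Finset.range 4) (f := fun k => w (N - 4 + k))
    rw [Finset.card_range] at a1 a2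
    omega
  have hbad : ∀ v, v ∉ bad → 4 ≤ pos v ∧ pos v + 5 ≤ N := by
    intro v hv
    simp only [bad, Finset.mem_union, Finset.mem_image, Finset.mem_range, not_or, not_exists,
      not_and] at hv
    have hvN := hposlt v
    constructor
    · by_contra hlt
      exact hv.1 (pos v) (by omega) (hwpos v)
    · by_contra hlt
      refine hv.2 (pos v - (N - 4)) (by omega) ?_
      rw [show N - 4 + (pos v - (N - 4)) = pos v by omega, hwpos]
  -- The requirement is `3 * (8 + 6 * J.card) ≤ N`, and its left side is `54 * Fintype.card κ - 48`.
  obtain ⟨f, hf, hffar⟩ := exists_far_edges K h2 (fun q : κ × Fin 3 => q.1) D hD hDs bad J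
    (by rw [hcard, hJcard]; omega)
  -- order the ends of the switched edges by position
  let a : κ × Fin 3 → V := fun q => if pos (f q).1 < pos (f q).2 then (f q).1 else (f q).2
  let b : κ × Fin 3 → V := fun q => if pos (f q).1 < pos (f q).2 then (f q).2 else (f q).1
  have hends : ∀ q u, u = a q ∨ u = b q → u = (f q).1 ∨ u = (f q).2 := by
    intro q u hu
    simp only [a, b] at hu
    split_ifs at hu <;> tauto
  have hadjab : ∀ q ∈ J, (K q.1).Adj (a q) (b q) := by
    intro q hq
    simp only [a, b]
    split_ifs
    · exact (hf q hq).1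
    · exact (hf q hq).1.symm
  have hablt : ∀ q ∈ J, pos (a q) < pos (b q) := by
    intro q hq
    have hne : pos (f q).1 ≠ pos (f q).2 := fun h => (hf q hq).1.ne (hposinj h)
    simp only [a, b]
    split_ifs <;> omega
  have hrange : ∀ q ∈ J, ∀ u, u = a q ∨ u = b q → 4 ≤ pos u ∧ pos u + 5 ≤ N := by
    intro q hq u hu
    rcases hends q u hu with rfl | rfl
    · exact hbad _ (hf q hq).2.1
    · exact hbad _ (hf q hq).2.2
  have hfar : ∀ q ∈ J, ∀ q' ∈ J, ∀ u u', u = a q ∨ u = b q → u' = a q' ∨ u' = b q' →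
      Near (pos u) (pos u') → q = q' ∧ u = u' := by
    intro q hq q' hq' u u' hu hu' hnear
    obtain rfl : q = q' := by
      by_contra hne
      refine hffar q hq q' hq' hne u u' (hends _ _ hu) (hends _ _ hu') ?_
      rwa [hDmem]
    refine ⟨rfl, ?_⟩
    -- Distinct near ends of one side edge would be consecutive on `K c₀`, putting that edge in two
    -- cycles.
    by_contra hne
    have hadj : (K q.1).Adj u u' := by
      rcases hu with rfl | rfl <;> rcases hu' with rfl | rfl
      · exact (hne rfl).elim
      · exact hadjab q hq
      · exact (hadjab q hq).symm
      · exact (hne rfl).elim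
    have hadj' : (K c₀).Adj u u' := by
      rcases hnear with h | h | h
      · exact (hne (hposinj h)).elim
      · have := hadjw (pos u)
        rwa [← h, hwpos, hwpos] at this
      · have := (hadjw (pos u')).symm
        rwa [← h, hwpos, hwpos] at this
    exact ((hJmem q.1 q.2).mp hq).1 (hK.eq_of_adj hadj hadj')
  obtain ⟨t, used, hused, hiso, t0, t1, tN4, tN3, tN2, hstep, hstep', havoid⟩ :=
    exists_levels hNe (by omega) J (by
      rw [hJcard]
      rw [Nat.even_iff] at hκ ⊢
      omega) (fun q => pos (a q)) (fun q => pos (b q)) (fun q => q.2) hablt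
      (fun q hq => (hrange q hq _ (Or.inl rfl)).1) (fun q hq => (hrange q hq _ (Or.inr rfl)).2)
      (by
        intro q hq q' hq' u u' hu hu' hnear
        obtain ⟨v, hv, rfl⟩ : ∃ v, (v = a q ∨ v = b q) ∧ pos v = u := by
          rcases hu with rfl | rfl
          · exact ⟨_, Or.inl rfl, rfl⟩
          · exact ⟨_, Or.inr rfl, rfl⟩
        obtain ⟨v', hv', rfl⟩ : ∃ v, (v = a q' ∨ v = b q') ∧ pos v = u' := by
          rcases hu' with rfl | rfl
          · exact ⟨_, Or.inl rfl, rfl⟩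
          · exact ⟨_, Or.inr rfl, rfl⟩
        obtain ⟨h1, h2⟩ := hfar q hq q' hq' v v' hv hv' hnear
        exact ⟨h1, by rw [h2]⟩)
  have used_lo : ∀ k, k < 3 → used k := by
    intro k hk
    rw [hused]
    intro q hq
    have := (hrange q hq _ (Or.inr rfl)).1
    omega
  have used_hi : ∀ k, N - 5 ≤ k → used k := by
    intro k hk
    rw [hused]
    intro q hq
    have := (hrange q hq _ (Or.inr rfl)).2
    omega
  have t_succ_ne : ∀ k, k + 1 ≤ N - 2 → used k → used (k + 1) → t k ≠ t (k + 1) := by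
    intro k hk u1 u2
    rcases Nat.eq_zero_or_pos k with rfl | hk0
    · rw [t0, t1]; decide
    · rcases hstep k hk0 hk u1 u2 with h | h <;> rw [h]
      · exact (fin4_add_one_ne _).symm
      · exact fin4_add_one_ne _
  -- `K c₀` is switched on the used path edges at level `t k`, every other cycle on its side edges
  -- at level `s`.
  let S : κ → V → V → Fin 4 → Prop := fun i x y l =>
    (i = c₀ ∧ ∃ k, k + 1 < N ∧ used k ∧ l = t k ∧ s(x, y) = s(w k, w (k + 1))) ∨
    ∃ s : Fin 3, (i, s) ∈ J ∧ l = s.castSucc ∧ s(x, y) = s(a (i, s), b (i, s))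
  have mem_of_eq : ∀ {x y u v : V}, s(x, y) = s(u, v) → x = u ∨ x = v := by
    intro x y u v h
    rcases Sym2.eq_iff.mp h with ⟨h, _⟩ | ⟨h, _⟩
    · exact Or.inl h
    · exact Or.inr h
  have pos_of_eq : ∀ {x y k}, k + 1 < N → s(x, y) = s(w k, w (k + 1)) →
      pos x = k ∨ pos x = k + 1 := by
    intro x y k hk h
    rcases mem_of_eq h with rfl | rfl
    · exact Or.inl (hposw k (by omega))
    · exact Or.inr (hposw _ hk)
  have hS : SwitchSystem K S := by
    refine ⟨?_, ?_, ?_, ?_⟩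
    · rintro i x y l (⟨rfl, k, hk, uk, rfl, hxy⟩ | ⟨s, hs, rfl, hxy⟩)
      · rw [← mem_edgeSet, hxy]
        exact hadjw k
      · rw [← mem_edgeSet, hxy]
        exact hadjab _ hs
    · intro i x y l hxy
      simp only [S] at hxy ⊢
      rwa [Sym2.eq_swap (a := y)]
    · rintro i j x y z l (⟨rfl, k, hk, uk, rfl, hxy⟩ | ⟨s, hs, rfl, hxy⟩)
        (⟨rfl, k', hk', uk', hl, hxz⟩ | ⟨s', hs', hl, hxz⟩)
      · have e1 := pos_of_eq hk hxy
        have e2 := pos_of_eq hk' hxz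
        obtain rfl : k = k' := by
          by_contra hne
          rcases (by omega : k' = k + 1 ∨ k = k' + 1) with rfl | rfl
          · exact t_succ_ne k (by omega) uk uk' hl
          · exact t_succ_ne k' (by omega) uk' uk hl.symm
        exact Sym2.congr_right.mp (hxy.trans hxz.symm)
      · exfalso
        have e1 := pos_of_eq hk hxy
        rcases mem_of_eq hxz with hx | hx
        · exact havoid _ hs' k uk (pos (a (j, s'))) (Or.inl rfl) (by rw [← hx]; omega) hl
        · exact havoid _ hs' k uk (pos (b (j, s'))) (Or.inr rfl) (by rw [← hx]; omega) hl
      · exfalso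
        have e1 := pos_of_eq hk' hxz
        rcases mem_of_eq hxy with hx | hx
        · exact havoid _ hs k' uk' (pos (a (i, s))) (Or.inl rfl) (by rw [← hx]; omega) hl.symm
        · exact havoid _ hs k' uk' (pos (b (i, s))) (Or.inr rfl) (by rw [← hx]; omega) hl.symm
      · have := (hfar _ hs _ hs' x x (mem_of_eq hxy) (mem_of_eq hxz) (Or.inl rfl)).1
        rw [← this] at hxz
        exact Sym2.congr_right.mp (hxy.trans hxz.symm)
    · rintro i x y l l' (⟨rfl, k, hk, uk, rfl, hxy⟩ | ⟨s, hs, rfl, hxy⟩)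
        (⟨hi, k', hk', uk', rfl, hxz⟩ | ⟨s', hs', rfl, hxz⟩)
      · have e1 := pos_of_eq hk hxy
        have e2 := pos_of_eq hk' hxz
        rw [Sym2.eq_swap] at hxy hxz
        have e3 := pos_of_eq hk hxy
        have e4 := pos_of_eq hk' hxz
        have e5 : pos x ≠ pos y := fun h => by
          rw [hposinj h] at hxy
          have := (hadjw k).ne
          rcases Sym2.eq_iff.mp hxy with ⟨h1, h2⟩ | ⟨h1, h2⟩
          · exact this (h1.symm.trans h2)
          · exact this (h2.symm.trans h1)
        rw [show k = k' by omega]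
      · exact (((hJmem _ _).mp hs').1 rfl).elim
      · exact (((hJmem _ _).mp hs).1 hi).elim
      · have := (hfar _ hs _ hs' x x (mem_of_eq hxy) (mem_of_eq hxz) (Or.inl rfl)).1
        rw [(Prod.mk.inj this).2]
  have S_main : ∀ k, k + 1 < N → used k → S c₀ (w k) (w (k + 1)) (t k) := fun k hk uk =>
    Or.inl ⟨rfl, k, hk, uk, rfl, rfl⟩
  have S_side : ∀ i s, (i, s) ∈ J → S i (a (i, s)) (b (i, s)) s.castSucc := fun i s hs =>
    Or.inr ⟨s, hs, rfl, rfl⟩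
  have S_side_range : ∀ {i x y l}, i ≠ c₀ → S i x y l →
      4 ≤ pos x ∧ pos x + 5 ≤ N ∧ ∃ s, (i, s) ∈ J ∧ l = s.castSucc ∧
        s(x, y) = s(a (i, s), b (i, s)) := by
    rintro i x y l hi (⟨h, _⟩ | ⟨s, hs, hl, hxy⟩)
    · exact (hi h).elim
    · have := hrange _ hs x (mem_of_eq hxy)
      exact ⟨this.1, this.2, s, hs, hl, hxy⟩
  have hpos0 : pos p₃ = 0 := by rw [← hw0]; exact hposw 0 (by omega)
  have hposN3 : pos p₀ = N - 3 := by rw [hwN3]; exact hposw _ (by omega)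
  have S_c₁_p₀ : ∀ y l, ¬ S c₁ p₀ y l := fun y l h => by
    have := S_side_range hc01.symm h
    omega
  -- the exchange between the cycles of `c₁` and `c₀`
  have gab : (hS.graphs (some c₁)).Adj (p₀, 0) (p₃, 0) :=
    Or.inl ⟨rfl, h03, S_c₁_p₀ _ _, S_c₁_p₀ _ _⟩
  have gcd : (hS.graphs (some c₁)).Adj (p₃, 1) (p₀, 1) :=
    Adj.symm (Or.inl ⟨rfl, h03, S_c₁_p₀ _ _, S_c₁_p₀ _ _⟩)
  have gbc : (hS.graphs (some c₀)).Adj (p₃, 0) (p₃, 1) := by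
    refine Or.inr (Or.inl ⟨rfl, rfl, w 1, ?_⟩)
    have := S_main 0 (by omega) (used_lo 0 (by omega))
    rwa [t0, hw0] at this
  have gda : (hS.graphs (some c₀)).Adj (p₀, 1) (p₀, 0) := by
    refine Or.inr (Or.inr ⟨rfl, rfl, w (N - 3 + 1), ?_⟩)
    have := S_main (N - 3) (by omega) (used_hi _ (by omega))
    rwa [tN3, ← hwN3] at this
  have hp03 : p₀ ≠ p₃ := h03.ne
  -- The square above `p₀p₃` between layers 0 and 1 alternates: its horizontal sides are in the
  -- graph of `c₁`, and its vertical ones in that of `c₀` because `t 0 = t (N - 3) = 0`.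
  obtain ⟨K', hK', h2', hK'o, hK'1, hK'0⟩ := (hS.edgePartition hK).exists_swap
    (hS.twoRegular hK h2) (α := some c₁) (β := some c₀) (by simpa using hc01.symm)
    (a := (p₀, 0)) (b := (p₃, 0)) (c := (p₃, 1)) (d := (p₀, 1)) (by simp) (by simp) gab gcd gbc gda
  have hside : ∀ {i u v l}, i ≠ c₀ → (K i).Adj u v →
      (∀ s, (i, s) ∈ J → l = s.castSucc ∨ l - 1 = s.castSucc → s(u, v) ≠ s(a (i, s), b (i, s))) →
      (hS.graphs (some i)).Adj (u, l) (v, l) := by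
    intro i u v l hi huv hne
    refine Or.inl ⟨rfl, huv, fun h => ?_, fun h => ?_⟩
    · obtain ⟨_, _, s, hs, hl, hxy⟩ := S_side_range hi h
      exact hne s hs (Or.inl hl) hxy
    · obtain ⟨_, _, s, hs, hl, hxy⟩ := S_side_range hi h
      exact hne s hs (Or.inr hl) hxy
  have hside_a : ∀ i s, (i, s) ∈ J →
      (hS.graphs (some i)).Adj (a (i, s), s.castSucc) (a (i, s), s.castSucc + 1) := fun i s hs =>
    Or.inr (Or.inl ⟨rfl, rfl, _, S_side i s hs⟩)
  have hside_b : ∀ i s, (i, s) ∈ J →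
      (hS.graphs (some i)).Adj (b (i, s), s.castSucc) (b (i, s), s.castSucc + 1) := fun i s hs =>
    Or.inr (Or.inl ⟨rfl, rfl, _, hS.symm (S_side i s hs)⟩)
  have levels : ∀ l : Fin 4, ∀ s : Fin 3, (l = s.castSucc ∨ l - 1 = s.castSucc) →
      (l = 0 → s = 0) ∧ (l = 1 → s = 0 ∨ s = 1) ∧ (l = 2 → s = 1 ∨ s = 2) ∧ (l = 3 → s = 2) := by
    decide
  have conn_none : (K' none).Connected := by
    rw [hK'o none (by simp) (by simp)]
    -- The parent of `v` in the tree of switched edges is the preceding vertex on the path, unless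
    -- that step is unused; then `v` is the later end of a side edge and its parent is the earlier
    -- end. Positions decrease towards the root `w 0`.
    have hex : ∀ v, ∃ pl : V × Fin 4, v ≠ w 0 → pos pl.1 < pos v ∧ ∃ i, S i v pl.1 pl.2 := by
      intro v
      by_cases hv : v = w 0
      · exact ⟨(v, 0), fun h => (h hv).elim⟩
      have hv0 : pos v ≠ 0 := fun h => hv (by rw [← hwpos v, h])
      have hvN := hposlt v
      by_cases hu : used (pos v - 1)
      · refine ⟨(w (pos v - 1), t (pos v - 1)), fun _ => ⟨?_, c₀, hS.symm ?_⟩⟩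
        · rw [hposw _ (by omega)]
          omega
        · have := S_main (pos v - 1) (by omega) hu
          rwa [show pos v - 1 + 1 = pos v by omega, hwpos] at this
      · rw [hused] at hu
        push Not at hu
        obtain ⟨⟨i, s⟩, hs, hb⟩ := hu
        have hvb : b (i, s) = v := hposinj (by omega)
        refine ⟨(a (i, s), s.castSucc), fun _ => ⟨?_, i, hS.symm ?_⟩⟩
        · rw [← hvb]
          exact hablt _ hs
        · rw [← hvb]
          exact S_side i s hs
    have huniq : ∀ {i j v x y l l'}, S i v x l → S j v y l' → pos x < pos v → pos y < pos v →
        x = y ∧ l = l' := by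
      have main_end : ∀ {v x k}, k + 1 < N → s(v, x) = s(w k, w (k + 1)) → pos x < pos v →
          pos v = k + 1 := by
        intro v x k hk hvx hlt
        have e1 := pos_of_eq hk hvx
        rw [Sym2.eq_swap] at hvx
        have e2 := pos_of_eq hk hvx
        omega
      have side_end : ∀ {v x q}, q ∈ J → s(v, x) = s(a q, b q) → pos x < pos v → v = b q := by
        intro v x q hq hvx hlt
        rcases Sym2.eq_iff.mp hvx with ⟨rfl, rfl⟩ | ⟨h, _⟩
        · have := hablt q hq
          omega
        · exact h
      rintro i j v x y l l' (⟨rfl, k, hk, uk, rfl, hxy⟩ | ⟨s, hs, rfl, hxy⟩)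
        (⟨rfl, k', hk', uk', rfl, hxz⟩ | ⟨s', hs', rfl, hxz⟩) hx hy
      · have e1 := main_end hk hxy hx
        have e2 := main_end hk' hxz hy
        obtain rfl : k = k' := by omega
        exact ⟨Sym2.congr_right.mp (hxy.trans hxz.symm), rfl⟩
      · have e1 := main_end hk hxy hx
        have e2 := side_end hs' hxz hy
        exact ((hused k).mp uk _ hs' (by rw [← e2, e1])).elim
      · have e1 := main_end hk' hxz hy
        have e2 := side_end hs hxy hx
        exact ((hused k').mp uk' _ hs (by rw [← e2, e1])).elim
      · have := (hfar _ hs _ hs' v v (mem_of_eq hxy) (mem_of_eq hxz) (Or.inl rfl)).1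
        rw [← this] at hxz
        exact ⟨Sym2.congr_right.mp (hxy.trans hxz.symm), by rw [(Prod.mk.inj this).2]⟩
    choose pl hpl using hex
    have hposr : pos (w 0) = 0 := hposw 0 (by omega)
    refine connected_of_columns pos hposlt (w 0) (fun v => (pl v).1) (fun v => (pl v).2)
      (fun v hv => (hpl v hv).1) (fun v hv => Or.inl ⟨rfl, Or.inl (hpl v hv).2⟩)
      (fun v hv => Or.inl ⟨rfl, Or.inr ?_⟩) ?_
    · simpa using (hpl v hv).2
    · intro v l
      by_cases hz : ∃ z i, S i v z l
      · right
        obtain ⟨z, i, hz⟩ := hz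
        rcases lt_trichotomy (pos z) (pos v) with hlt | heq | hgt
        · left
          have hv : v ≠ w 0 := by
            rintro rfl
            omega
          obtain ⟨h1, j, h3⟩ := hpl v hv
          exact ⟨hv, (huniq hz h3 hlt h1).2⟩
        · exact ((hS.adj hz).ne (hposinj heq.symm)).elim
        · right
          have hv : z ≠ w 0 := by
            rintro rfl
            omega
          obtain ⟨h1, j, h3⟩ := hpl z hv
          have := huniq (hS.symm hz) h3 hgt h1
          exact ⟨z, hv, this.1.symm, this.2.symm⟩
      · left
        push Not at hz
        exact Or.inr (Or.inl ⟨rfl, rfl, fun z ⟨i, hi⟩ => hz z i hi⟩)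
  have conn_side : ∀ i, i ≠ c₀ → i ≠ c₁ → (K' (some i)).Connected := by
    intro i hi0 hi1
    have hmem : ∀ s, (i, s) ∈ J := fun s => (hJmem i s).mpr ⟨hi0, fun h => hi1 h.1⟩
    rw [hK'o (some i) (by simpa using hi1) (by simpa using hi0)]
    refine connected_of_layers hN3 (hc i) (hadjab _ (hmem 0)) (hadjab _ (hmem 1))
      (hadjab _ (hmem 2)) ?_ ?_ ?_ ?_ (hside_a i 0 (hmem 0)) (hside_b i 0 (hmem 0))
      (hside_a i 1 (hmem 1)) (hside_b i 1 (hmem 1)) (hside_a i 2 (hmem 2))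
    · intro u v huv hne
      refine hside hi0 huv fun s _ hs => ?_
      rw [(levels _ s hs).1 rfl]
      exact hne
    · intro u v huv hne hne'
      refine hside hi0 huv fun s _ hs => ?_
      rcases (levels _ s hs).2.1 rfl with rfl | rfl
      · exact hne
      · exact hne'
    · intro u v huv hne hne'
      refine hside hi0 huv fun s _ hs => ?_
      rcases (levels _ s hs).2.2.1 rfl with rfl | rfl
      · exact hne
      · exact hne'
    · intro u v huv hne
      refine hside hi0 huv fun s _ hs => ?_
      rw [(levels _ s hs).2.2.2 rfl]
      exact hne
  have sym2_proj : ∀ {u v x y : V} {l l₁ l₂ : Fin 4}, s((u, l), (v, l)) = s((x, l₁), (y, l₂)) →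
      s(u, v) = s(x, y) ∧ l = l₁ ∧ l = l₂ := by
    intro u v x y l l₁ l₂ h
    rcases Sym2.eq_iff.mp h with ⟨h1, h2⟩ | ⟨h1, h2⟩
    · obtain ⟨rfl, rfl⟩ := Prod.mk.inj h1
      obtain ⟨rfl, rfl⟩ := Prod.mk.inj h2
      exact ⟨rfl, rfl, rfl⟩
    · obtain ⟨rfl, rfl⟩ := Prod.mk.inj h1
      obtain ⟨rfl, rfl⟩ := Prod.mk.inj h2
      exact ⟨Sym2.eq_swap, rfl, rfl⟩
  have sym2_proj_vert : ∀ {x y z : V} {l l' l₁ l₂ : Fin 4},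
      s((x, l), (x, l')) = s((y, l₁), (z, l₂)) → x = y ∧ x = z ∧ s(l, l') = s(l₁, l₂) := by
    intro x y z l l' l₁ l₂ h
    rcases Sym2.eq_iff.mp h with ⟨h1, h2⟩ | ⟨h1, h2⟩
    · obtain ⟨rfl, rfl⟩ := Prod.mk.inj h1
      obtain ⟨rfl, rfl⟩ := Prod.mk.inj h2
      exact ⟨rfl, rfl, rfl⟩
    · obtain ⟨rfl, rfl⟩ := Prod.mk.inj h1
      obtain ⟨rfl, rfl⟩ := Prod.mk.inj h2
      exact ⟨rfl, rfl, Sym2.eq_swap⟩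
  have conn_c₁ : (K' (some c₁)).Connected := by
    have hmem1 : (c₁, 1) ∈ J := (hJmem _ _).mpr ⟨hc01.symm, by simp⟩
    have hmem2 : (c₁, 2) ∈ J := (hJmem _ _).mpr ⟨hc01.symm, by simp⟩
    have hnot0 : (c₁, 0) ∉ J := fun h => ((hJmem _ _).mp h).2 ⟨rfl, rfl⟩
    have hhor : ∀ {u v l}, (K c₁).Adj u v → (∀ s, (c₁, s) ∈ J → l = s.castSucc ∨ l - 1 = s.castSucc →
        s(u, v) ≠ s(a (c₁, s), b (c₁, s))) → (l = 0 ∨ l = 1 → s(u, v) ≠ s(p₀, p₃)) →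
        (K' (some c₁)).Adj (u, l) (v, l) := by
      intro u v l huv hne hne'
      refine (hK'1 _ _).mpr (Or.inl ⟨hside hc01.symm huv hne, fun h => ?_, fun h => ?_⟩)
      · obtain ⟨h1, h2, -⟩ := sym2_proj h
        exact hne' (Or.inl h2) h1
      · obtain ⟨h1, h2, -⟩ := sym2_proj h
        exact hne' (Or.inr h2) (h1.trans Sym2.eq_swap)
    have hver : ∀ {x l}, (hS.graphs (some c₁)).Adj (x, l) (x, l + 1) →
        (K' (some c₁)).Adj (x, l) (x, l + 1) := by
      intro x l hx
      refine (hK'1 _ _).mpr (Or.inl ⟨hx, fun h => ?_, fun h => ?_⟩)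
      · obtain ⟨h1, h2, -⟩ := sym2_proj_vert h
        exact hp03 (h1.symm.trans h2)
      · obtain ⟨h1, h2, -⟩ := sym2_proj_vert h
        exact hp03 (h2.symm.trans h1)
    -- The exchanged edge `p₀p₃` plays the part of the absent level 0 switch.
    refine connected_of_layers hN3 (hc c₁) h03 (hadjab _ hmem1) (hadjab _ hmem2) ?_ ?_ ?_ ?_
      ((hK'1 _ _).mpr (Or.inr (Or.inr Sym2.eq_swap))) ((hK'1 _ _).mpr (Or.inr (Or.inl rfl)))
      (hver (hside_a c₁ 1 hmem1)) (hver (hside_b c₁ 1 hmem1)) (hver (hside_a c₁ 2 hmem2))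
    · intro u v huv hne
      refine hhor huv (fun s hsJ hs => ?_) fun _ => hne
      rw [(levels _ s hs).1 rfl] at hsJ
      exact (hnot0 hsJ).elim
    · intro u v huv hne hne'
      refine hhor huv (fun s hsJ hs => ?_) fun _ => hne
      rcases (levels _ s hs).2.1 rfl with rfl | rfl
      · exact (hnot0 hsJ).elim
      · exact hne'
    · intro u v huv hne hne'
      refine hhor huv (fun s hsJ hs => ?_) fun h => absurd h (by decide)
      rcases (levels _ s hs).2.2.1 rfl with rfl | rfl
      · exact hne
      · exact hne'
    · intro u v huv hne
      refine hhor huv (fun s hsJ hs => ?_) fun h => absurd h (by decide)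
      rw [(levels _ s hs).2.2.2 rfl]
      exact hne
  have conn_c₀ : (K' (some c₀)).Connected := by
    have hhor : ∀ {u v l}, (hS.graphs (some c₀)).Adj (u, l) (v, l) →
        (K' (some c₀)).Adj (u, l) (v, l) := by
      intro u v l huv
      refine (hK'0 _ _).mpr (Or.inl ⟨huv, fun h => ?_, fun h => ?_⟩)
      · obtain ⟨-, h1, h2⟩ := sym2_proj h
        exact absurd (h1.symm.trans h2) (by decide)
      · obtain ⟨-, h1, h2⟩ := sym2_proj h
        exact absurd (h1.symm.trans h2) (by decide)
    have hS0 : ∀ {x y l}, S c₀ x y l →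
        ∃ k, k + 1 < N ∧ used k ∧ l = t k ∧ s(x, y) = s(w k, w (k + 1)) := by
      rintro x y l (⟨_, h⟩ | ⟨s, hs, _⟩)
      · exact h
      · exact (((hJmem _ _).mp hs).1 rfl).elim
    have hcons : ∀ {k k'}, k + 1 < N → k' + 1 < N → s(w k, w (k + 1)) = s(w k', w (k' + 1)) →
        k = k' := by
      intro k k' hk hk' h
      have e1 := pos_of_eq hk' h
      rw [Sym2.eq_swap] at h
      have e2 := pos_of_eq hk' h
      rw [hposw _ (by omega)] at e1 e2
      omega
    have hver : ∀ {x l}, (hS.graphs (some c₀)).Adj (x, l) (x, l + 1) →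
        ((x ≠ p₀ ∧ x ≠ p₃) ∨ l ≠ 0) → (K' (some c₀)).Adj (x, l) (x, l + 1) := by
      have hl0 : ∀ l : Fin 4, (s(l, l + 1) = s(0, 1) ∨ s(l, l + 1) = s(1, 0)) → l = 0 := by decide
      intro x l hx hor
      refine (hK'0 _ _).mpr (Or.inl ⟨hx, fun h => ?_, fun h => ?_⟩)
      · obtain ⟨h1, -, h2⟩ := sym2_proj_vert h
        have := hl0 l (Or.inl h2)
        tauto
      · obtain ⟨h1, -, h2⟩ := sym2_proj_vert h
        have := hl0 l (Or.inr h2)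
        tauto
    refine connected_of_zigzag (by omega) w (fun x => ⟨pos x, hposlt x, hwpos x⟩) t used ?_ ?_ ?_ ?_
      ?_ ?_ (used_lo 0 (by omega)) (used_lo 1 (by omega)) (used_hi _ (by omega))
      (used_hi _ (by omega)) (used_hi _ (by omega)) t0 t1 tN4 tN3 tN2
      (fun k h1 h2 => hstep k h1 (by omega)) (fun k h1 h2 => hstep' k h1 (by omega)) hiso
    · intro k l hk hl
      refine hhor (Or.inl ⟨rfl, hadjw k, fun h => ?_, fun h => ?_⟩)
      · obtain ⟨k', hk', uk', hl', he⟩ := hS0 h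
        obtain rfl := hcons (by omega) hk' he
        exact (hl uk').1 hl'
      · obtain ⟨k', hk', uk', hl', he⟩ := hS0 h
        obtain rfl := hcons (by omega) hk' he
        refine (hl uk').2 ?_
        rw [← hl']
        simp
    · intro l
      have hnS : ∀ l, ¬ S c₀ (w (N - 1)) (w 0) l := by
        intro l h
        obtain ⟨k', hk', uk', hl', he⟩ := hS0 h
        have e1 := pos_of_eq hk' he
        rw [Sym2.eq_swap] at he
        have e2 := pos_of_eq hk' he
        rw [hposw _ (by omega)] at e1 e2
        omega
      refine hhor (Or.inl ⟨rfl, ?_, hnS _, hnS _⟩)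
      have := hadjw (N - 1)
      rwa [show N - 1 + 1 = N by omega, hwN] at this
    · intro k hk uk
      refine hver (Or.inr (Or.inl ⟨rfl, rfl, _, hS.symm (S_main k (by omega) uk)⟩)) ?_
      -- The vertex is then `w (N - 3) = p₀`, but the level is 3 and the exchange only touched level
      -- 0.
      by_cases hk4 : k = N - 4
      · right
        rw [hk4, tN4]
        decide
      · left
        constructor
        · rw [hwN3]
          intro h
          have := hwinj (by omega) (by omega) h
          omega
        · rw [← hw0]
          intro h
          have := hwinj (by omega) (by omega) h
          omega
    · intro k hk uk hk0 hk3
      refine hver (Or.inr (Or.inl ⟨rfl, rfl, _, S_main k (by omega) uk⟩)) ?_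
      left
      constructor
      · rw [hwN3]
        intro h
        exact hk3 (hwinj (by omega) (by omega) h)
      · rw [← hw0]
        intro h
        exact hk0 (hwinj (by omega) (by omega) h)
    · rw [← hwN3, hw0]
      exact (hK'0 _ _).mpr (Or.inr (Or.inr rfl))
    · rw [← hwN3, hw0]
      exact (hK'0 _ _).mpr (Or.inr (Or.inl Sym2.eq_swap))
  have hhook : HasHook K' := by
    -- The new hook sits at an intact cycle `i`: with `z` the unswitched neighbour of `a (i, 1)`,
    -- the path `(z, 1), (a, 1), (a, 2), (z, 2)` lies in its graph, whereas the vertical edge above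
    -- `z` does not.
    obtain ⟨i, hi⟩ : ∃ i, i ∉ ({c₀, c₁} : Finset κ) := by
      by_contra hall
      push Not at hall
      have h1 := Finset.card_le_card (fun x _ => hall x : Finset.univ ⊆ ({c₀, c₁} : Finset κ))
      rw [Finset.card_univ] at h1
      have := Finset.card_le_two (a := c₀) (b := c₁)
      omega
    simp only [Finset.mem_insert, Finset.mem_singleton, not_or] at hi
    have hmem : (i, 1) ∈ J := (hJmem _ _).mpr ⟨hi.1, fun h => hi.2 h.1⟩
    have hKi : K' (some i) = hS.graphs (some i) :=
      hK'o (some i) (by simpa using hi.2) (by simpa using hi.1)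
    have hab := hadjab _ hmem
    obtain ⟨z, hz, hzb⟩ : ∃ z, (K i).Adj (a (i, 1)) z ∧ z ≠ b (i, 1) := by
      obtain ⟨n₁, n₂, hne, hn⟩ := h2 i (a (i, 1))
      by_cases h : n₁ = b (i, 1)
      · exact ⟨n₂, (hn _).mpr (Or.inr rfl), fun h' => hne (h.trans h'.symm)⟩
      · exact ⟨n₁, (hn _).mpr (Or.inl rfl), h⟩
    have hnS : ∀ l, ¬ S i (a (i, 1)) z l := by
      intro l hl
      obtain ⟨-, -, s, hs, -, he⟩ := S_side_range hi.1 hl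
      have := (hfar _ hmem _ hs _ _ (Or.inl rfl) (mem_of_eq he) (Or.inl rfl)).1
      rw [← this] at he
      exact hzb (Sym2.congr_right.mp he)
    have hadj1 : ∀ l, (K' (some i)).Adj (a (i, 1), l) (z, l) := fun l => by
      rw [hKi]
      exact Or.inl ⟨rfl, hz, hnS _, hnS _⟩
    have hbox : (G □ fourCycle).Adj (z, 1) (z, 2) := Or.inr ⟨Or.inl rfl, rfl⟩
    obtain ⟨c, hcadj, -⟩ := hK'.existsUnique hbox
    have hci : some i ≠ c := by
      rintro rfl
      rw [hKi] at hcadj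
      rcases hcadj with ⟨h, -⟩ | ⟨-, -, y, hy⟩ | ⟨-, h, -⟩
      · exact absurd (show (1 : Fin 4) = 2 from h) (by decide)
      · obtain ⟨-, -, s, hs, hl, he⟩ := S_side_range hi.1 hy
        have hs1 : ∀ s : Fin 3, (1 : Fin 4) = s.castSucc → s = 1 := by decide
        obtain rfl := hs1 s hl
        rcases mem_of_eq he with h | h
        · exact hz.ne h.symm
        · exact hzb h
      · exact absurd (show (1 : Fin 4) = 2 + 1 from h) (by decide)
    refine ⟨some i, c, (z, 1), (a (i, 1), 1), (a (i, 1), 2), (z, 2), hci, by simp, by simp,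
      (hadj1 1).symm, ?_, hadj1 2, hcadj⟩
    rw [hKi]
    exact hside_a i 1 hmem
  refine ⟨K', hK', fun c => ?_, hhook⟩
  have hcon : (K' c).Connected := by
    cases c with
    | none => exact conn_none
    | some i =>
      by_cases hi0 : i = c₀
      · rw [hi0]; exact conn_c₀
      · by_cases hi1 : i = c₁
        · rw [hi1]; exact conn_c₁
        · exact conn_side i hi0 hi1
  have := (h2' c).isHamCycle hcon
  rwa [Fintype.card_prod, hcard, Fintype.card_fin] at this

/-! ### Explicit decompositions for two and three factors -/

/-- A Hamilton decomposition given by explicit enumerations of its cycles. -/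
theorem hookDecomposable_of_enumeration {V κ : Type*} {M : ℕ} (hM : 4 ≤ M) {G : SimpleGraph V}
    (pos : κ → V → ℕ) (vert : κ → ℕ → V) (hlt : ∀ i x, pos i x < M)
    (hvp : ∀ i x, vert i (pos i x) = x) (hpv : ∀ i, ∀ k < M, pos i (vert i k) = k)
    (hadj : ∀ i, ∀ k < M, G.Adj (vert i k) (vert i ((k + 1) % M)))
    (huniq : ∀ x y, G.Adj x y →
      ∃ i, (pos i y = (pos i x + 1) % M ∨ pos i x = (pos i y + 1) % M) ∧
        ∀ j, (pos j y = (pos j x + 1) % M ∨ pos j x = (pos j y + 1) % M) → j = i)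
    {i j : κ} (hij : i ≠ j)
    (hhook : pos j (vert i 3) = (pos j (vert i 0) + 1) % M ∨
      pos j (vert i 0) = (pos j (vert i 3) + 1) % M) :
    HookDecomposable κ M G := by
  have : NeZero M := ⟨by omega⟩
  have : Fact (1 < M) := ⟨by omega⟩
  let e : κ → V ≃ ZMod M := fun i =>
    { toFun := fun x => (pos i x : ZMod M)
      invFun := fun k => vert i k.val
      left_inv := fun x => by
        change vert i (pos i x : ZMod M).val = x
        rw [ZMod.val_natCast, Nat.mod_eq_of_lt (hlt i x), hvp]
      right_inv := fun k => by
        change (pos i (vert i k.val) : ZMod M) = k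
        rw [hpv i _ (ZMod.val_lt k), ZMod.natCast_val, ZMod.cast_id] }
  have he : ∀ i x y, e i y = e i x + 1 ↔ pos i y = (pos i x + 1) % M := by
    intro i x y
    change (pos i y : ZMod M) = (pos i x : ZMod M) + 1 ↔ _
    rw [← Nat.cast_one, ← Nat.cast_add, ZMod.natCast_eq_natCast_iff, Nat.ModEq,
      Nat.mod_eq_of_lt (hlt i y)]
  let K : κ → SimpleGraph V := fun i =>
    { Adj := fun x y => e i y = e i x + 1 ∨ e i x = e i y + 1
      symm := ⟨fun _ _ h => h.symm⟩
      loopless := ⟨fun x h => by simp at h⟩ }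
  have hKadj : ∀ i x y, (K i).Adj x y ↔
      (pos i y = (pos i x + 1) % M ∨ pos i x = (pos i y + 1) % M) := fun i x y => by
    rw [← he, ← he]
  have hpath : ∀ k, k + 1 < M → (K i).Adj (vert i k) (vert i (k + 1)) := fun k hk => by
    rw [hKadj, hpv i k (by omega), hpv i _ hk, Nat.mod_eq_of_lt hk]
    exact Or.inl rfl
  have hne : ∀ k k', k < M → k' < M → k ≠ k' → vert i k ≠ vert i k' := fun k k' hk hk' h heq => by
    have := congrArg (pos i) heq
    rw [hpv i k hk, hpv i k' hk'] at this
    exact h this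
  refine ⟨K, ⟨fun i x y hxy => ?_, fun x y hxy => ?_⟩, fun i => ⟨e i, fun x y => Iff.rfl⟩,
    i, j, vert i 0, vert i 1, vert i 2, vert i 3, hij, hne 0 2 (by omega) (by omega) (by omega),
    hne 1 3 (by omega) (by omega) (by omega), hpath 0 (by omega), hpath 1 (by omega),
    hpath 2 (by omega), (hKadj _ _ _).mpr hhook⟩
  · rcases (hKadj i x y).mp hxy with h | h
    · have := hadj i _ (hlt i x)
      rwa [hvp, ← h, hvp] at this
    · have := hadj i _ (hlt i y)
      rw [hvp, ← h, hvp] at this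
      exact this.symm
  · simp only [hKadj]
    exact huniq x y hxy

instance : DecidableRel (fourCycle □ fourCycle).Adj := fun _ _ =>
  decidable_of_iff _ boxProd_adj.symm

instance : DecidableRel ((fourCycle □ fourCycle) □ fourCycle).Adj := fun _ _ =>
  decidable_of_iff _ boxProd_adj.symm

theorem fourCycle_isHamCycle : IsHamCycle 4 fourCycle :=
  ⟨Equiv.refl (Fin 4), fun _ _ => Iff.rfl⟩

/-- The positions of the vertices on the two cycles of a decomposition of `C₄ □ C₄`. -/
def torusPos (i : Bool) (x : Fin 4 × Fin 4) : ℕ :=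
  match i with
  -- The staircase again: row `X` begins at `Y = -X`, so the offset within the row is `X + Y`.
  | false => 4 * x.1 + (x.1 + x.2 : Fin 4)
  | true => 4 * x.2 + (x.2 + x.1 : Fin 4)

/-- The vertices of the two cycles of a decomposition of `C₄ □ C₄`. -/
def torusVert (i : Bool) (k : ℕ) : Fin 4 × Fin 4 :=
  match i with
  | false => (Fin.ofNat 4 (k / 4), Fin.ofNat 4 k - Fin.ofNat 4 (k / 4))
  | true => (Fin.ofNat 4 k - Fin.ofNat 4 (k / 4), Fin.ofNat 4 (k / 4))

theorem hookDecomposable_two : HookDecomposable Bool 16 (fourCycle □ fourCycle) :=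
  hookDecomposable_of_enumeration (by norm_num) torusPos torusVert (by decide) (by decide)
    (by decide) (by decide) (by decide) (i := false) (j := true) (by decide) (by decide)

/-- A Hamilton cycle of `C₄ □ C₄ □ C₄`, in base-4 notation, whose images under the cyclic shifts of
the coordinates are edge-disjoint. -/
def cubeCycle : List ℕ :=
  [0, 12, 60, 48, 49, 61, 13, 1, 17, 16, 28, 29, 45, 33, 32, 44,
    47, 31, 15, 11, 7, 6, 5, 53, 52, 56, 57, 41, 40, 24, 25, 21,
    20, 36, 37, 38, 22, 23, 39, 55, 54, 50, 34, 35, 51, 63, 62, 14,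
    2, 3, 19, 18, 30, 46, 42, 26, 27, 43, 59, 58, 10, 9, 8, 4]

/-- The positions of the vertices on `cubeCycle`. -/
def cubeCyclePos : List ℕ :=
  [0, 7, 48, 49, 63, 22, 21, 20, 62, 61, 60, 19, 1, 6, 47, 18,
    9, 8, 51, 50, 32, 31, 36, 37, 29, 30, 55, 56, 10, 11, 52, 17,
    14, 13, 42, 43, 33, 34, 35, 38, 28, 27, 54, 57, 15, 12, 53, 16,
    3, 4, 41, 44, 24, 23, 40, 39, 25, 26, 59, 58, 2, 5, 46, 45]

/-- Cyclic shifts of the three coordinates. -/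
def cubeShift (i : Fin 3) (x : (Fin 4 × Fin 4) × Fin 4) : (Fin 4 × Fin 4) × Fin 4 :=
  match i with
  | 0 => x
  | 1 => ((x.1.2, x.2), x.1.1)
  | 2 => ((x.2, x.1.1), x.1.2)

/-- The positions of the vertices on the three shifts of `cubeCycle`. -/
def cubePos (i : Fin 3) (x : (Fin 4 × Fin 4) × Fin 4) : ℕ :=
  cubeCyclePos.getD (16 * (cubeShift i x).1.1 + 4 * (cubeShift i x).1.2 + (cubeShift i x).2) 0

/-- The vertices of the three shifts of `cubeCycle`. -/
def cubeVert (i : Fin 3) (k : ℕ) : (Fin 4 × Fin 4) × Fin 4 :=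
  let v := cubeCycle.getD k 0
  cubeShift (-i) ((Fin.ofNat 4 (v / 16), Fin.ofNat 4 (v / 4)), Fin.ofNat 4 v)

set_option maxRecDepth 100000 in
theorem hookDecomposable_three :
    HookDecomposable (Fin 3) 64 ((fourCycle □ fourCycle) □ fourCycle) := by
  obtain ⟨j, hj, hj'⟩ : ∃ j, (0 : Fin 3) ≠ j ∧
      (cubePos j (cubeVert 0 3) = (cubePos j (cubeVert 0 0) + 1) % 64 ∨
      cubePos j (cubeVert 0 0) = (cubePos j (cubeVert 0 3) + 1) % 64) := by decide
  exact hookDecomposable_of_enumeration (by norm_num) cubePos cubeVert (by decide) (by decide)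
    (by decide) (by decide) (by decide) hj hj'

/-! ### Hypercubes as products, and the induction -/

/-- The box product of two isomorphisms. -/
def boxProdCongr {V V' W W' : Type*} {G : SimpleGraph V} {G' : SimpleGraph V'}
    {H : SimpleGraph W} {H' : SimpleGraph W'} (f : G ≃g G') (g : H ≃g H') :
    (G □ H) ≃g (G' □ H') where
  toEquiv := f.toEquiv.prodCongr g.toEquiv
  map_rel_iff' := by
    rintro ⟨x, y⟩ ⟨x', y'⟩
    have hf : G'.Adj (f x) (f x') ↔ G.Adj x x' := f.map_rel_iff
    have hg : H'.Adj (g y) (g y') ↔ H.Adj y y' := g.map_rel_iff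
    simp [boxProd_adj, hf, hg]

theorem hypercube_adj {n : ℕ} (x y : Finset (Fin n)) :
    (hypercube n).Adj x y ↔ (symmDiff x y).card = 1 := Iff.rfl

/-- The hypercube of dimension `a + b` is a product of hypercubes. -/
def hypercubeAdd (a b : ℕ) : hypercube (a + b) ≃g (hypercube a □ hypercube b) where
  toEquiv := (finSumFinEquiv.symm.finsetCongr).trans Finset.sumEquiv.toEquiv
  map_rel_iff' := by
    intro x y
    let g : Finset (Fin (a + b)) → Finset (Fin a ⊕ Fin b) := finSumFinEquiv.symm.finsetCongr
    have hg : (symmDiff (g x) (g y)).card = (symmDiff x y).card := by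
      have : symmDiff (g x) (g y) = g (symmDiff x y) := by
        simp only [g, Equiv.finsetCongr_apply, Finset.map_eq_image]
        exact (Finset.image_symmDiff _ _ (Equiv.injective _)).symm
      rw [this]
      simp [g]
    have hl : (symmDiff (g x) (g y)).toLeft = symmDiff (g x).toLeft (g y).toLeft := by
      ext; simp [Finset.mem_symmDiff]
    have hr : (symmDiff (g x) (g y)).toRight = symmDiff (g x).toRight (g y).toRight := by
      ext; simp [Finset.mem_symmDiff]
    have hsum := Finset.card_toLeft_add_card_toRight (u := symmDiff (g x) (g y))
    rw [hl, hr, hg] at hsum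
    change (hypercube a □ hypercube b).Adj ((g x).toLeft, (g x).toRight)
      ((g y).toLeft, (g y).toRight) ↔ _
    have h0 : ∀ {n} (s t : Finset (Fin n)), s = t ↔ (symmDiff s t).card = 0 := by
      intro n s t
      rw [Finset.card_eq_zero, ← Finset.bot_eq_empty, symmDiff_eq_bot]
    rw [boxProd_adj, hypercube_adj, hypercube_adj, hypercube_adj]
    simp only [h0]
    omega

instance (n : ℕ) : DecidableRel (hypercube n).Adj := fun x y =>
  inferInstanceAs (Decidable ((symmDiff x y).card = 1))

theorem nonempty_iso_fourCycle : Nonempty (hypercube 2 ≃g fourCycle) := by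
  let f : Fin 4 → Finset (Fin 2) := ![∅, {0}, {0, 1}, {1}]
  have hf : Function.Bijective f := by decide
  have hadj : ∀ l l', (hypercube 2).Adj (f l) (f l') ↔ fourCycle.Adj l l' := by decide
  exact ⟨(⟨Equiv.ofBijective f hf, fun {l l'} => hadj l l'⟩ : fourCycle ≃g hypercube 2).symm⟩

theorem hamDecomposable_hypercube_two : HamDecomposable (Fin 1) 4 (hypercube 2) := by
  obtain ⟨f⟩ := nonempty_iso_fourCycle
  refine HamDecomposable.of_iso ⟨fun _ => fourCycle, ⟨fun _ => le_rfl, fun x y h => ?_⟩,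
    fun _ => fourCycle_isHamCycle⟩ f
  exact ⟨0, h, fun j _ => Subsingleton.elim _ _⟩

/-- Even `m` comes from doubling `m / 2`, odd `m ≥ 5` from adding a 4-cycle to `m - 1`; two and
three factors are the explicit cases. -/
theorem hookDecomposable_hypercube (m : ℕ) (hm : 2 ≤ m) :
    HookDecomposable (Fin m) (4 ^ m) (hypercube (2 * m)) := by
  obtain ⟨f⟩ := nonempty_iso_fourCycle
  induction m using Nat.strong_induction_on with
  | _ m ih =>
    rcases hm.eq_or_lt with rfl | hm2
    · exact (hookDecomposable_two.of_iso ((hypercubeAdd 2 2).trans (boxProdCongr f f))).reindex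
        (Fintype.equivOfCardEq (by simp))
    rcases (Nat.succ_le_of_lt hm2).eq_or_lt with rfl | hm3
    · exact hookDecomposable_three.of_iso ((hypercubeAdd 4 2).trans
        (boxProdCongr ((hypercubeAdd 2 2).trans (boxProdCongr f f)) f))
    rcases Nat.even_or_odd' m with ⟨k, rfl | rfl⟩
    · have hk : 4 ≤ 4 ^ k := by
        calc 4 = 4 ^ 1 := by norm_num
          _ ≤ 4 ^ k := Nat.pow_le_pow_right (by norm_num) (by omega)
      have h := ((ih k (by omega) (by omega)).boxProd_self hk).of_iso (hypercubeAdd (2 * k) (2 * k))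
      rw [show 2 * k + 2 * k = 2 * (2 * k) by ring, show 4 ^ k * 4 ^ k = 4 ^ (2 * k) by ring] at h
      exact h.reindex (Fintype.equivOfCardEq (by simp [mul_comm]))
    -- The bound starts at `216 ≤ 256` and would fail for `k = 1`, which is why three factors are
    -- treated by hand.
    · have hpow : ∀ k, 2 ≤ k → 54 * (2 * k) ≤ 4 ^ (2 * k) := by
        intro k hk
        induction k, hk using Nat.le_induction with
        | base => norm_num
        | succ k hk ih =>
          rw [show 2 * (k + 1) = 2 * k + 2 by ring, pow_add]
          omega
      have h := ((ih (2 * k) (by omega) (by omega)).boxProd_fourCycle (by simp) (by simp; omega)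
        ((by decide : Even 4).pow_of_ne_zero (by omega)) (by simpa using hpow k (by omega))).of_iso
        ((hypercubeAdd (2 * (2 * k)) 2).trans (boxProdCongr Iso.refl f))
      rw [show 2 * (2 * k) + 2 = 2 * (2 * k + 1) by ring, ← pow_succ] at h
      exact h.reindex (Fintype.equivOfCardEq (by simp))

theorem hamDecomposable_hypercube (m : ℕ) (hm : 1 ≤ m) :
    HamDecomposable (Fin m) (4 ^ m) (hypercube (2 * m)) := by
  rcases hm.eq_or_lt with rfl | hm2
  · exact hamDecomposable_hypercube_two
  · exact (hookDecomposable_hypercube m hm2).hamDecomposable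

/-! ### Cutting Hamilton cycles into paths -/

/-- Cutting the cycles of a Hamilton decomposition into paths of length `L`. -/
theorem HamDecomposable.divides_kPath {V κ : Type*} [Fintype κ] [Nonempty κ] {N L : ℕ}
    {G : SimpleGraph V} (h : HamDecomposable κ N G) (hN : 3 ≤ N) (hL : 0 < L) (hLN : L < N)
    (hdvd : L ∣ N) : Divides (kPath L) G := by
  obtain ⟨K, hK, hc⟩ := h
  choose e he using hc
  obtain ⟨M, hM⟩ := hdvd
  have : NeZero N := ⟨by omega⟩
  have two_ne := zmod_two_ne_zero hN
  have hstep : ∀ i k, (K i).Adj ((e i).symm k) ((e i).symm (k + 1)) := fun i k => by simp [he]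
  let E : κ → ZMod N → Sym2 V := fun i k => s((e i).symm k, (e i).symm (k + 1))
  -- The edges of all cycles are listed without repetition; `2 ≠ 0` excludes an edge met in reverse.
  have hEinj : ∀ {i i' k k'}, E i k = E i' k' → i = i' ∧ k = k' := by
    intro i i' k k' hE
    have hadj : (K i').Adj ((e i).symm k) ((e i).symm (k + 1)) := by
      rw [← mem_edgeSet]
      change E i k ∈ _
      rw [hE]
      exact hstep i' k'
    obtain rfl := hK.eq_of_adj (hstep i k) hadj
    refine ⟨rfl, ?_⟩
    simp only [E, Sym2.eq_iff, EmbeddingLike.apply_eq_iff_eq] at hE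
    rcases hE with ⟨h1, _⟩ | ⟨h1, h2⟩
    · exact h1
    · exact (two_ne (by linear_combination h2 - h1)).elim
  -- The path `(i, q)` occupies positions `q * L` to `q * L + L` of cycle `i`. Its `L + 1` vertices
  -- are distinct because `L < N`; successive paths share only an end vertex.
  let θ : κ × Fin M → Copy (kPath L) G := fun c =>
    { toHom :=
        { toFun := fun r => (e c.1).symm ((c.2 * L + r : ℕ) : ZMod N)
          map_rel' := by
            intro r r' hr
            refine hK.le c.1 ?_
            rw [he]
            simp only [Equiv.apply_symm_apply]
            rcases pathGraph_adj.mp hr with h | h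
            · left; rw [← h]; push_cast; ring
            · right; rw [← h]; push_cast; ring }
      injective' := by
        intro r r' hr
        have h1 := (e c.1).symm.injective hr
        rw [ZMod.natCast_eq_natCast_iff] at h1
        have h2 := Nat.ModEq.add_left_cancel' _ h1
        have hr := r.2
        have hr' := r'.2
        exact Fin.ext (h2.eq_of_lt_of_lt (by omega) (by omega)) }
  have hθ : ∀ c z, z ∈ imageEdges (θ c) ↔ ∃ r, r < L ∧ z = E c.1 ((c.2 * L + r : ℕ) : ZMod N) := by
    intro c z
    have hval : ∀ r : Fin (L + 1), θ c r = (e c.1).symm ((c.2 * L + r : ℕ) : ZMod N) :=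
      fun r => rfl
    constructor
    · rintro ⟨z', hz', rfl⟩
      induction z' using Sym2.ind with
      | _ r r' =>
        rw [Sym2.map_mk]
        have hr := r.2
        have hr' := r'.2
        rcases pathGraph_adj.mp hz' with h | h <;> simp only at h
        · refine ⟨r, by omega, ?_⟩
          rw [hval, hval, ← h]
          simp only [E]
          push_cast
          rw [add_assoc]
        · refine ⟨r', by omega, ?_⟩
          rw [hval, hval, ← h, Sym2.eq_swap]
          simp only [E]
          push_cast
          rw [add_assoc]
    · rintro ⟨r, hr, rfl⟩
      refine ⟨s(⟨r, by omega⟩, ⟨r + 1, by omega⟩), pathGraph_adj.mpr (Or.inl rfl), ?_⟩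
      rw [Sym2.map_mk, hval, hval]
      simp only [E]
      push_cast
      rw [add_assoc]
  have hlt : ∀ (q : Fin M) r, r < L → q * L + r < N := by
    intro q r hr
    calc q * L + r < q * L + L := by omega
      _ = (q + 1) * L := by ring
      _ ≤ M * L := Nat.mul_le_mul_right _ q.2
      _ = N := by rw [hM, mul_comm]
  have hdisj : ∀ c c', c ≠ c' → Disjoint (imageEdges (θ c)) (imageEdges (θ c')) := by
    intro c c' hne
    rw [Set.disjoint_left]
    intro z hz hz'
    obtain ⟨r, hr, rfl⟩ := (hθ c z).mp hz
    obtain ⟨r', hr', hE⟩ := (hθ c' _).mp hz'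
    obtain ⟨h1, h2⟩ := hEinj hE
    rw [ZMod.natCast_eq_natCast_iff] at h2
    have h3 := h2.eq_of_lt_of_lt (hlt _ _ hr) (hlt _ _ hr')
    apply hne
    refine Prod.ext h1 (Fin.ext ?_)
    have h4 := congrArg (· / L) h3
    simpa [Nat.add_div_of_dvd_right, Nat.mul_add_div, mul_comm _ L, hL, Nat.div_eq_of_lt hr,
      Nat.div_eq_of_lt hr'] using h4
  have hunion : ⋃ c, imageEdges (θ c) = G.edgeSet := by
    ext z
    rw [Set.mem_iUnion]
    constructor
    · rintro ⟨c, hz⟩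
      obtain ⟨r, hr, rfl⟩ := (hθ c z).mp hz
      exact hK.le _ (hstep _ _)
    · intro hz
      induction z using Sym2.ind with
      | _ x y =>
        obtain ⟨i, hi, -⟩ := hK.existsUnique hz
        obtain ⟨k, hk⟩ : ∃ k, s(x, y) = E i k := by
          rcases (he i x y).mp hi with h | h
          · exact ⟨e i x, by simp [E, ← h]⟩
          · exact ⟨e i y, by simp [E, ← h, Sym2.eq_swap]⟩
        have hkN := ZMod.val_lt k
        have hq : k.val / L < M := by
          rw [Nat.div_lt_iff_lt_mul hL, mul_comm, ← hM]
          exact hkN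
        refine ⟨(i, ⟨k.val / L, hq⟩), (hθ _ _).mpr ⟨k.val % L, Nat.mod_lt _ hL, ?_⟩⟩
        rw [hk]
        simp only
        rw [mul_comm, Nat.div_add_mod, ZMod.natCast_val, ZMod.cast_id]
  have hM0 : 0 < M := by
    rcases Nat.eq_zero_or_pos M with rfl | h
    · omega
    · exact h
  refine ⟨⟨θ (Classical.arbitrary κ, ⟨0, hM0⟩)⟩, Fintype.card (κ × Fin M),
    fun c => θ ((Fintype.equivFin _).symm c), fun c c' hne => ?_, ?_⟩
  · exact hdisj _ _ fun h => hne ((Fintype.equivFin _).symm.injective h)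
  · rw [← hunion]
    exact (Fintype.equivFin (κ × Fin M)).symm.surjective.iUnion_comp fun c => imageEdges (θ c)

end CubeDecomp

theorem proposition6 (n j : ℕ) (hn : Even n) (hj : j < n) :
    CubeDecomp.Divides (CubeDecomp.kPath (2 ^ j)) (CubeDecomp.hypercube n) := by
  obtain ⟨m, rfl⟩ := hn.two_dvd
  have hm : 1 ≤ m := by omega
  have : Nonempty (Fin m) := ⟨⟨0, hm⟩⟩
  have hN : 4 ^ m = 2 ^ (2 * m) := by rw [pow_mul]; norm_num
  refine (CubeDecomp.hamDecomposable_hypercube m hm).divides_kPath ?_ (by positivity) ?_ ?_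
  · calc 3 ≤ 4 ^ 1 := by norm_num
      _ ≤ 4 ^ m := Nat.pow_le_pow_right (by norm_num) hm
  · rw [hN]
    exact Nat.pow_lt_pow_right (by norm_num) hj
  · rw [hN]
    exact pow_dvd_pow 2 hj.le
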